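/- Let $M$ be a smooth manifold (finite-dimensional, without boundary, Hausdorff, $\sigma$-compact) and let $\xi\subset TM$ be a smooth co-oriented hyperplane distribution: each annihilator line $\operatorname{Ann}(\xi_x)\subset T_x^*M$ carries a positive ray, and locally $\xi=\ker\eta$ for a nowhere vanishing smooth 1-form $\eta$ spanning the positive rays. Let $N=\operatorname{Ann}^+(\xi)\subset T^*M$ be the set of all positive covectors, and let $\omega_N$ be the restriction to $N$ of the standard symplectic form $d\theta$ of $T^*M$, with $\theta$ the tautological 1-form. The bundle $\mathcal E^1(M)$ is $\mathbb A=A\oplus(V\otimes A^*)$. Here $A=TM\oplus\mathbb R\,\partial_t$ is the Lie algebroid with bracket $[X+f\partial_t,Y+g\partial_t]=[X,Y]+(X(g)-Y(f))\partial_t$, and $V$ is the line bundle spanned by a symbol $e^t$, on which $A$ acts by $(X+f\partial_t)(e^th)=e^t(X(h)+fh)$. With $d$ the differential of $\Gamma(V\otimes\wedge^\bullet A^*)$ and $\mathcal L_X=d\iota_X+\iota_Xd$, $\mathbb A$ carries the $V$-valued pairing $\langle X+\alpha,Y+\beta\rangle=\iota_X\beta+\iota_Y\alpha$ and the bracket $[\![X+\alpha,Y+\beta]\!]=[X,Y]+\mathcal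 L_X\beta-\iota_Yd\alpha$. An $\mathcal E^1(M)$-Dirac structure is a smooth subbundle $L\subset\mathbb A$ with $L^\perp=L$ whose smooth sections are closed under the bracket. Then there is a global smooth 1-form $\eta$ with $\eta_x\in\operatorname{Ann}^+(\xi_x)$ for all $x$, and for every such $\eta$ the following hold. 1. The map $(x,s)\mapsto e^s\eta_x$ is a smooth embedding $M\times\mathbb R\to T^*M$ (a smooth injective immersion that is a homeomorphism onto its image) with image $N$. It carries the translation action of $\mathbb R$ on the second factor to scaling of the fibres of $N$ by $e^t$. 2. Identify $N$ with $M\times\mathbb R$ by this map. The graph $L=\{(X,\iota_X\omega_N)\}\subset TN\oplus T^*N$ is invariant under the action of $\mathbb R$ by translation on $TN$ and by translation with weight $e^t$ on $T^*N$, so that it has a quotient $\tilde L_\xi=L/\mathbb R$ in $(TN\oplus T^*N)/\mathbb R=\mathcal E^1(M)$. Here the quotient map at $(x,s)$ is $(v+a\partial_t,\alpha)\mapsto(v+a\partial_t,\;e^t\otimes e^{-s}\alpha)$, so that $TN/\mathbb R=A$. 3. $\tilde L_\xi$ is an $\mathcal E^1(M)$-Dirac structure. 4. $\xi$ is a contact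 structure (that is, for every local smooth 1-form $\eta'$ with $\xi=\ker\eta'$, the form $d\eta'$ is non-degenerate on $\xi$) if and only if $\tilde L_\xi\cap A=0$ at every point of $M$, where $A\subset\mathbb A=A\oplus(V\otimes A^*)$ is embedded by the canonical splitting. -/

import Mathlib

open Set Bundle Topology
open scoped Manifold ContDiff

noncomputable section

namespace ContactDirac

section Forms

/-! ### Forms of degree 1 and 2 on a manifold, and the cotangent bundle -/

variable {E : Type*} [NormedAddCommGroup E] [NormedSpace ℝ E]
  {H : Type*} [TopologicalSpace H] (I : ModelWithCorners ℝ E H)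
  {M : Type*} [TopologicalSpace M] [ChartedSpace H M]

/-- The cotangent space `T_x^*M`. -/
abbrev CotangentSpace (x : M) : Type _ := TangentSpace I x →L[ℝ] ℝ

/-- Bilinear forms on `T_x M`, written as maps `v ↦ ι_v ω` from `T_x M` to `T_x^*M`. -/
abbrev TwoFormAt (x : M) : Type _ := TangentSpace I x →L[ℝ] CotangentSpace I x

/-- A 1-form `α` on `M` read in the chart `extChartAt I x₀`, a map from the model space to its
dual: the pullback of `α` under the inverse chart. -/
def formInChart (α : ∀ x : M, CotangentSpace I x) (x₀ : M) (y : E) : E →L[ℝ] ℝ :=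
  (α ((extChartAt I x₀).symm y)).comp
    (mfderivWithin 𝓘(ℝ, E) I (extChartAt I x₀).symm (range I) y)

/-- The exterior derivative of a 1-form: in the chart at `x`, it is
`dα(u, v) = (D_u α)(v) - (D_v α)(u)`, pulled back to `T_x M` by the derivative of the chart. -/
def extDerivOneForm (α : ∀ x : M, CotangentSpace I x) (x : M) : TwoFormAt I x :=
  let D : E →L[ℝ] E →L[ℝ] ℝ := fderivWithin ℝ (formInChart I α x) (range I) (extChartAt I x x)
  let c : TangentSpace I x →L[ℝ] E := mfderiv I 𝓘(ℝ, E) (extChartAt I x) x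
  (ContinuousLinearMap.precomp ℝ c).comp ((D - D.flip).comp c)

/-- The differential of a function, as a 1-form. -/
def dFun (f : M → ℝ) (x : M) : CotangentSpace I x := mfderiv I 𝓘(ℝ, ℝ) f x

variable (M) in
/-- The total space of the cotangent bundle `T^*M`, a manifold modelled on
`I.prod 𝓘(ℝ, E →L[ℝ] ℝ)`. -/
abbrev CotangentBundle : Type _ :=
  TotalSpace (E →L[ℝ] ℝ) (fun x : M => TangentSpace I x →L[ℝ] ℝ)

/-- The point of `T^*M` given by a covector at `x`. -/
abbrev covectorPoint (x : M) (p : CotangentSpace I x) : CotangentBundle I M :=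
  TotalSpace.mk' (E →L[ℝ] ℝ) x p

variable [IsManifold I ∞ M]

/-- A 1-form is smooth on `U` if it is smooth there as a section of `T^*M`. -/
def SmoothFormOn (α : ∀ x : M, CotangentSpace I x) (U : Set M) : Prop :=
  ContMDiffOn I (I.prod 𝓘(ℝ, E →L[ℝ] ℝ)) ∞ (fun x => covectorPoint I x (α x)) U

/-- The tautological (Liouville) 1-form `θ_p(v) = p(dπ v)` on `T^*M`. -/
def liouvilleForm (p : CotangentBundle I M) :
    CotangentSpace (I.prod 𝓘(ℝ, E →L[ℝ] ℝ)) p :=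
  p.2.comp (mfderiv (I.prod 𝓘(ℝ, E →L[ℝ] ℝ)) I
    (fun q : CotangentBundle I M => q.proj) p)

/-- The standard symplectic form on `T^*M`, with the sign convention `ω = dθ`. -/
def canonicalForm (p : CotangentBundle I M) :
    TwoFormAt (I.prod 𝓘(ℝ, E →L[ℝ] ℝ)) p :=
  extDerivOneForm (I.prod 𝓘(ℝ, E →L[ℝ] ℝ)) (liouvilleForm I (M := M)) p

end Forms

section E1

/-! ### The bundle `𝓔¹(M)` and its Dirac structures

`A = TM ⊕ ℝ ∂_t`, and `V` is the line bundle spanned by `e^t`.  A section `e^t h` of `V` is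
represented by `h`, and an element `e^t ⊗ (α + φ dt)` of `V ⊗ A^*` by the functional
`(v, a) ↦ α v + φ a` on `A`. -/

variable {E : Type*} [NormedAddCommGroup E] [NormedSpace ℝ E]
  {H : Type*} [TopologicalSpace H] (I : ModelWithCorners ℝ E H)
  {M : Type*} [TopologicalSpace M] [ChartedSpace H M]

/-- The fibre of `A = TM ⊕ ℝ ∂_t`; the pair `(v, a)` is `v + a ∂_t`. -/
abbrev AFiber (x : M) : Type _ := TangentSpace I x × ℝ

/-- The fibre of `V ⊗ A^*`. -/
abbrev ADual (x : M) : Type _ := AFiber I x →L[ℝ] ℝ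

/-- The fibre of `𝓔¹(M) = A ⊕ (V ⊗ A^*)`. -/
abbrev E1Fiber (x : M) : Type _ := AFiber I x × ADual I x

/-- The component `α` of `e^t ⊗ (α + φ dt)`. -/
def horizontalPart {x : M} (β : ADual I x) : CotangentSpace I x :=
  β.comp (ContinuousLinearMap.inl ℝ (TangentSpace I x) ℝ)

/-- The component `φ` of `e^t ⊗ (α + φ dt)`. -/
def verticalPart {x : M} (β : ADual I x) : ℝ := β (0, 1)

/-- The Lie bracket `[X + f ∂_t, Y + g ∂_t] = [X, Y] + (X g - Y f) ∂_t` on sections of `A`. -/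
def bracketA (X Y : ∀ x : M, AFiber I x) (x : M) : AFiber I x :=
  (VectorField.mlieBracket I (fun y => (X y).1) (fun y => (Y y).1) x,
    dFun I (fun y => (Y y).2) x (X x).1 - dFun I (fun y => (X y).2) x (Y x).1)

/-- The differential `d : Γ(V) → Γ(V ⊗ A^*)`, that is, the action of `A` on `V`:
`(v + a ∂_t) · (e^t h) = e^t (v h + a h)`. -/
def dV (h : M → ℝ) (x : M) : ADual I x :=
  (dFun I h x).comp (ContinuousLinearMap.fst ℝ (TangentSpace I x) ℝ)
    + h x • ContinuousLinearMap.snd ℝ (TangentSpace I x) ℝ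

/-- The contraction `ι_u dβ` for a section `β` of `V ⊗ A^*` and `u = v + a ∂_t` in `A_x`, where
`d : Γ(V ⊗ A^*) → Γ(V ⊗ ∧² A^*)` is the differential of the `A`-module `V`:
`d (e^t ⊗ (α + φ dt)) = e^t ⊗ (dα + dφ ∧ dt + dt ∧ α)`. -/
def contractD (β : ∀ x : M, ADual I x) (x : M) (u : AFiber I x) : ADual I x :=
  let α : CotangentSpace I x := horizontalPart I (β x)
  let dα : TwoFormAt I x := extDerivOneForm I (fun y => horizontalPart I (β y)) x
  let dφ : CotangentSpace I x := dFun I (fun y => verticalPart I (β y)) x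
  (dα u.1 - u.2 • dφ + u.2 • α).comp (ContinuousLinearMap.fst ℝ (TangentSpace I x) ℝ)
    + (dφ u.1 - α u.1) • ContinuousLinearMap.snd ℝ (TangentSpace I x) ℝ

/-- The Lie derivative `𝓛_X β = d ι_X β + ι_X dβ` of a section `β` of `V ⊗ A^*`. -/
def lieD (X : ∀ x : M, AFiber I x) (β : ∀ x : M, ADual I x) (x : M) : ADual I x :=
  dV I (fun y => β y (X y)) x + contractD I β x (X x)

/-- The bracket `⟦X + ξ, Y + η⟧ = [X, Y] + 𝓛_X η - ι_Y dξ` on sections of `𝓔¹(M)`. -/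
def courantBracket (σ τ : ∀ x : M, E1Fiber I x) (x : M) : E1Fiber I x :=
  (bracketA I (fun y => (σ y).1) (fun y => (τ y).1) x,
    lieD I (fun y => (σ y).1) (fun y => (τ y).2) x
      - contractD I (fun y => (σ y).2) x (τ x).1)

/-- The `V`-valued pairing `⟨X + ξ, Y + η⟩ = ι_X η + ι_Y ξ`. -/
def pairing {x : M} (e e' : E1Fiber I x) : ℝ := e'.2 e.1 + e.2 e'.1

/-- The subspace `A_x` of `𝓔¹(M)_x`, embedded by the canonical splitting. -/
def splittingA (x : M) : Submodule ℝ (E1Fiber I x) :=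
  LinearMap.range (LinearMap.inl ℝ (AFiber I x) (ADual I x))

variable [IsManifold I ∞ M]

/-- A section of `𝓔¹(M)` is smooth if its components in `TM`, `ℝ`, `T^*M` and `ℝ` are. -/
structure SmoothSectionOn (σ : ∀ x : M, E1Fiber I x) (U : Set M) : Prop where
  vector : ContMDiffOn I I.tangent ∞ (fun x => (⟨x, (σ x).1.1⟩ : TangentBundle I M)) U
  func : ContMDiffOn I 𝓘(ℝ, ℝ) ∞ (fun x => (σ x).1.2) U
  form : SmoothFormOn I (fun x => horizontalPart I (σ x).2) U
  cofunc : ContMDiffOn I 𝓘(ℝ, ℝ) ∞ (fun x => verticalPart I (σ x).2) U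

/-- An `𝓔¹(M)`-Dirac structure: a smooth subbundle `L` with `L^⊥ = L` whose sections are closed
under the bracket. -/
structure IsE1Dirac (L : ∀ x : M, Submodule ℝ (E1Fiber I x)) : Prop where
  subbundle : ∀ x₀ : M, ∃ U : Set M, IsOpen U ∧ x₀ ∈ U ∧
    ∃ (k : ℕ) (b : Fin k → ∀ x : M, E1Fiber I x),
      (∀ i, SmoothSectionOn I (b i) U) ∧
      ∀ x ∈ U, LinearIndependent ℝ (fun i => b i x) ∧
        Submodule.span ℝ (range fun i => b i x) = L x
  lagrangian : ∀ (x : M) (e : E1Fiber I x), e ∈ L x ↔ ∀ u ∈ L x, pairing I e u = 0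
  involutive : ∀ σ τ : ∀ x : M, E1Fiber I x,
    SmoothSectionOn I σ univ → SmoothSectionOn I τ univ →
    (∀ x, σ x ∈ L x) → (∀ x, τ x ∈ L x) → ∀ x, courantBracket I σ τ x ∈ L x

end E1

section Quotient

/-! ### The quotient of the standard Courant algebroid on `M × ℝ` by `ℝ`

`ℝ` acts on `M × ℝ` by translation of the second factor, and on the trivial line bundle over it
with weight `e^t`. -/

variable {E : Type*} [NormedAddCommGroup E] [NormedSpace ℝ E]
  {H : Type*} [TopologicalSpace H] (I : ModelWithCorners ℝ E H)
  {M : Type*} [TopologicalSpace M] [ChartedSpace H M]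

/-- The fibre at `p` of the standard Courant algebroid `TP ⊕ T^*P` on `P = M × ℝ`. -/
abbrev StdFiber (p : M × ℝ) : Type _ :=
  TangentSpace (I.prod 𝓘(ℝ, ℝ)) p × CotangentSpace (I.prod 𝓘(ℝ, ℝ)) p

/-- The translation of `M × ℝ` by `t`. -/
def translate (t : ℝ) (p : M × ℝ) : M × ℝ := (p.1, p.2 + t)

/-- The action of `t` on `TP ⊕ T^*P`, from the fibre at `p` to the fibre at `translate t p`.
The derivative of the translation is the identity of `T_x M × ℝ`; covectors are moved along and
multiplied by the weight `e^t`. -/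
def shift (t : ℝ) (p : M × ℝ) : StdFiber I p ≃ₗ[ℝ] StdFiber I (translate t p) :=
  LinearEquiv.prodCongr (LinearEquiv.refl ℝ (E × ℝ))
    (LinearEquiv.smulOfNeZero ℝ ((E × ℝ) →L[ℝ] ℝ) (Real.exp t) (Real.exp_ne_zero t))

/-- The projection of `TP ⊕ T^*P` to its quotient `(TP ⊕ T^*P)/ℝ = 𝓔¹(M)`, on the fibre at
`p = (x, s)`: with `T_p P = T_x M × ℝ = A_x`, a covector is divided by the frame `e^s` of the
invariant functions. -/
def toQuotient (p : M × ℝ) : StdFiber I p ≃ₗ[ℝ] E1Fiber I p.1 :=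
  LinearEquiv.prodCongr (LinearEquiv.refl ℝ (E × ℝ))
    (LinearEquiv.smulOfNeZero ℝ ((E × ℝ) →L[ℝ] ℝ) (Real.exp (-p.2)) (Real.exp_ne_zero _))

/-- The projection to the quotient is constant on orbits. -/
theorem toQuotient_shift (t : ℝ) (p : M × ℝ) (e : StdFiber I p) :
    toQuotient I (translate t p) (shift I t p e) = toQuotient I p e := by
  refine Prod.ext rfl ?_
  change Real.exp (-(p.2 + t)) • (Real.exp t • e.2) = Real.exp (-p.2) • e.2
  rw [smul_smul, ← Real.exp_add]
  congr 2
  ring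

/-- The quotient by `ℝ` of a family `L` of subspaces of `TP ⊕ T^*P`: the elements of `𝓔¹(M)_x`
whose corresponding invariant section along `{x} × ℝ` lies in `L`. -/
def quotientFamily (L : ∀ p : M × ℝ, Submodule ℝ (StdFiber I p)) (x : M) :
    Submodule ℝ (E1Fiber I x) :=
  ⨅ s : ℝ, (L (x, s)).comap (toQuotient I (x, s)).symm.toLinearMap

end Quotient

section Distributions

/-! ### Co-oriented hyperplane distributions, the cone `Ann⁺(ξ)` and its Dirac structure -/

variable {E : Type*} [NormedAddCommGroup E] [NormedSpace ℝ E]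
  {H : Type*} [TopologicalSpace H] (I : ModelWithCorners ℝ E H)
  (M : Type*) [TopologicalSpace M] [ChartedSpace H M] [IsManifold I ∞ M]

/-- A smooth hyperplane distribution `ξ ⊂ TM` with a co-orientation: `plane x` is `ξ_x`, and
`pos x` is the ray of positive covectors in the annihilator of `ξ_x`.  Locally
`ξ = ker η` for a smooth nowhere vanishing 1-form `η` that spans the positive rays. -/
structure CoorientedDistribution where
  plane : ∀ x : M, Submodule ℝ (TangentSpace I x)
  pos : ∀ x : M, Set (CotangentSpace I x)
  locally_defined : ∀ x₀ : M, ∃ U : Set M, IsOpen U ∧ x₀ ∈ U ∧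
    ∃ η : ∀ x : M, CotangentSpace I x, SmoothFormOn I η U ∧
      ∀ x ∈ U, η x ≠ 0 ∧ plane x = LinearMap.ker (η x).toLinearMap ∧
        pos x = {p | ∃ c : ℝ, 0 < c ∧ p = c • η x}

variable {I M}

namespace CoorientedDistribution

variable (ξ : CoorientedDistribution I M)

/-- `ξ` is a contact structure: for each local defining 1-form `η`, `dη` is non-degenerate
on `ξ = ker η`. -/
def IsContact : Prop :=
  ∀ (U : Set M) (η : ∀ x : M, CotangentSpace I x), IsOpen U → SmoothFormOn I η U →
    (∀ x ∈ U, ξ.plane x = LinearMap.ker (η x).toLinearMap) →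
    ∀ x ∈ U, ∀ v ∈ ξ.plane x, (∀ w ∈ ξ.plane x, extDerivOneForm I η x v w = 0) → v = 0

/-- The cone `Ann⁺(ξ) ⊂ T^*M`. -/
def annPos : Set (CotangentBundle I M) := {p | p.2 ∈ ξ.pos p.proj}

/-- A global 1-form defining `ξ` with its co-orientation, that is, a global section of
`Ann⁺(ξ) → M`. -/
def IsPositiveForm (η : ∀ x : M, CotangentSpace I x) : Prop :=
  SmoothFormOn I η univ ∧ ∀ x, η x ∈ ξ.pos x

end CoorientedDistribution

variable (I) (η : ∀ x : M, CotangentSpace I x)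

/-- The parametrization `(x, s) ↦ e^s η_x` of the cone through `η`. -/
def coneMap (p : M × ℝ) : CotangentBundle I M :=
  covectorPoint I p.1 (Real.exp p.2 • η p.1)

/-- The 2-form `ω_N` on the cone, in the parametrization `coneMap`: the pullback of the standard
symplectic form of `T^*M`. -/
def coneForm (p : M × ℝ) : TwoFormAt (I.prod 𝓘(ℝ, ℝ)) p :=
  let c := mfderiv (I.prod 𝓘(ℝ, ℝ)) (I.prod 𝓘(ℝ, E →L[ℝ] ℝ)) (coneMap I η) p
  (ContinuousLinearMap.precomp ℝ c).comp ((canonicalForm I (coneMap I η p)).comp c)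

/-- The graph of `X ↦ ι_X ω_N`, a family of subspaces of `TN ⊕ T^*N`. -/
def coneGraph (p : M × ℝ) : Submodule ℝ (StdFiber I p) :=
  LinearMap.graph (coneForm I η p).toLinearMap

/-- The quotient by `ℝ` of the graph of `ω_N`, in `𝓔¹(M)`. -/
def contactDirac (x : M) : Submodule ℝ (E1Fiber I x) :=
  quotientFamily I (coneGraph I η) x

end Distributions

end ContactDirac

end

namespace ContactDirac

section Charts

variable {E : Type*} [NormedAddCommGroup E] [NormedSpace ℝ E]
  {H : Type*} [TopologicalSpace H] (I : ModelWithCorners ℝ E H)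
  {M : Type*} [TopologicalSpace M] [ChartedSpace H M]

/-- The derivative of a chart, as an endomorphism of the model space. -/
noncomputable def chartDeriv (x₀ x : M) : E →L[ℝ] E := mfderiv I 𝓘(ℝ, E) (extChartAt I x₀) x

/-- The derivative of the inverse of a chart, as an endomorphism of the model space. -/
noncomputable def chartSymmDeriv (x₀ : M) (y : E) : E →L[ℝ] E :=
  mfderivWithin 𝓘(ℝ, E) I (extChartAt I x₀).symm (range I) y

theorem formInChart_apply (α : ∀ x : M, CotangentSpace I x) (x₀ : M) (y v : E) :
    formInChart I α x₀ y v = α ((extChartAt I x₀).symm y) (chartSymmDeriv I x₀ y v) := rfl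

variable [IsManifold I ∞ M]

theorem chartDeriv_chartSymmDeriv (x₀ : M) {y : E} (hy : y ∈ (extChartAt I x₀).target) (v : E) :
    chartDeriv I x₀ ((extChartAt I x₀).symm y) (chartSymmDeriv I x₀ y v) = v := by
  have : IsManifold I 1 M := .of_le (n := ∞) (by simp)
  exact congr($(mfderiv_extChartAt_comp_mfderivWithin_extChartAt_symm (I := I) hy) v)

theorem chartSymmDeriv_chartDeriv (x₀ : M) {x : M} (hx : x ∈ (extChartAt I x₀).source) (v : E) :
    chartSymmDeriv I x₀ (extChartAt I x₀ x) (chartDeriv I x₀ x v) = v := by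
  have : IsManifold I 1 M := .of_le (n := ∞) (by simp)
  exact congr($(mfderivWithin_extChartAt_symm_comp_mfderiv_extChartAt' (I := I) hx) v)

theorem chartDeriv_self (x : M) : chartDeriv I x x = ContinuousLinearMap.id ℝ E := by
  have : IsManifold I 1 M := .of_le (n := ∞) (by simp)
  exact mfderiv_extChartAt_self

theorem cotangent_trivializationAt_apply (x₀ : M) (q : CotangentBundle I M)
    (hq : q.proj ∈ (extChartAt I x₀).source) (v : E) :
    (trivializationAt (E →L[ℝ] ℝ) (fun x : M => TangentSpace I x →L[ℝ] ℝ) x₀ q).2 v =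
      q.2 (chartSymmDeriv I x₀ (extChartAt I x₀ q.proj) v) := by
  have : IsManifold I 1 M := .of_le (n := ∞) (by simp)
  rw [extChartAt_source] at hq
  rw [hom_trivializationAt_apply, chartSymmDeriv, ← TangentBundle.symmL_trivializationAt hq]
  simp [ContinuousLinearMap.inCoordinates]
  rfl

theorem tangent_trivializationAt_apply (x₀ : M) (q : TangentBundle I M)
    (hq : q.proj ∈ (extChartAt I x₀).source) :
    (trivializationAt E (TangentSpace I : M → Type _) x₀ q).2 = chartDeriv I x₀ q.proj q.2 := by
  have : IsManifold I 1 M := .of_le (n := ∞) (by simp)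
  rw [extChartAt_source] at hq
  have h := (trivializationAt E (TangentSpace I : M → Type _) x₀).coe_linearMapAt_of_mem (R := ℝ)
    (b := q.proj) (by simpa using hq)
  rw [chartDeriv, ← TangentBundle.continuousLinearMapAt_trivializationAt hq]
  exact (congrFun h q.2).symm

theorem formInChart_extChartAt (α : ∀ x : M, CotangentSpace I x) (x₀ : M) {x : M}
    (hx : x ∈ (extChartAt I x₀).source) :
    formInChart I α x₀ (extChartAt I x₀ x) =
      (trivializationAt (E →L[ℝ] ℝ) (fun x : M => TangentSpace I x →L[ℝ] ℝ) x₀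
        (covectorPoint I x (α x))).2 := by
  ext v
  rw [cotangent_trivializationAt_apply I x₀ _ hx, formInChart_apply]
  exact congrArg (fun z => (α z : E →L[ℝ] ℝ) (chartSymmDeriv I x₀ (extChartAt I x₀ x) v))
    ((extChartAt I x₀).left_inv hx)

theorem apply_eq_formInChart (α : ∀ x : M, CotangentSpace I x) (x₀ : M) {x : M}
    (hx : x ∈ (extChartAt I x₀).source) (v : E) :
    α x v = formInChart I α x₀ (extChartAt I x₀ x) (chartDeriv I x₀ x v) := by
  rw [formInChart_apply, chartSymmDeriv_chartDeriv I x₀ hx]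
  exact congrArg (fun z => (α z : E →L[ℝ] ℝ) v) ((extChartAt I x₀).left_inv hx).symm

variable [I.Boundaryless]

theorem contDiffAt_iff_contMDiffAt_comp_extChartAt {F : Type*} [NormedAddCommGroup F]
    [NormedSpace ℝ F] (x₀ : M) {x : M} (hx : x ∈ (extChartAt I x₀).source) (f : E → F) :
    ContDiffAt ℝ ∞ f (extChartAt I x₀ x) ↔
      ContMDiffAt I 𝓘(ℝ, F) ∞ (fun z => f (extChartAt I x₀ z)) x := by
  rw [extChartAt_source] at hx
  refine ⟨fun h => h.contMDiffAt.comp x (contMDiffAt_extChartAt' hx), fun h => ?_⟩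
  have hx' : x ∈ (extChartAt I x₀).source := by rwa [extChartAt_source]
  have h1 : ContMDiffAt 𝓘(ℝ, E) I ∞ (extChartAt I x₀).symm (extChartAt I x₀ x) :=
    (contMDiffOn_extChartAt_symm x₀).contMDiffAt
      ((isOpen_extChartAt_target x₀).mem_nhds ((extChartAt I x₀).map_source hx'))
  rw [← (extChartAt I x₀).left_inv hx'] at h
  rw [← contMDiffAt_iff_contDiffAt]
  refine (h.comp (extChartAt I x₀ x) h1).congr_of_eventuallyEq ?_
  filter_upwards [(isOpen_extChartAt_target x₀).mem_nhds ((extChartAt I x₀).map_source hx')]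
    with y hy
  exact congrArg f ((extChartAt I x₀).right_inv hy).symm

theorem contMDiffAt_iff_comp_extChartAt_symm {F : Type*} [NormedAddCommGroup F]
    [NormedSpace ℝ F] (x₀ : M) {x : M} (hx : x ∈ (extChartAt I x₀).source) (f : M → F) :
    ContMDiffAt I 𝓘(ℝ, F) ∞ f x ↔
      ContDiffAt ℝ ∞ (f ∘ (extChartAt I x₀).symm) (extChartAt I x₀ x) := by
  rw [contDiffAt_iff_contMDiffAt_comp_extChartAt I x₀ hx]
  refine Filter.EventuallyEq.contMDiffAt_iff ?_
  filter_upwards [(isOpen_extChartAt_source (I := I) x₀).mem_nhds hx] with y hy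
  exact congrArg f ((extChartAt I x₀).left_inv hy).symm

/-- A 1-form is smooth at a point if and only if its expression in a chart is. -/
theorem contMDiffAt_form_iff (α : ∀ x : M, CotangentSpace I x) (x₀ : M) {x : M}
    (hx : x ∈ (extChartAt I x₀).source) :
    ContMDiffAt I (I.prod 𝓘(ℝ, E →L[ℝ] ℝ)) ∞ (fun x => covectorPoint I x (α x)) x ↔
      ContDiffAt ℝ ∞ (formInChart I α x₀) (extChartAt I x₀ x) := by
  have hb : x ∈ (trivializationAt (E →L[ℝ] ℝ)
      (fun x : M => TangentSpace I x →L[ℝ] ℝ) x₀).baseSet := by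
    simpa using hx
  rw [Trivialization.contMDiffAt_section_iff _ hb,
    contDiffAt_iff_contMDiffAt_comp_extChartAt I x₀ hx]
  refine Filter.EventuallyEq.contMDiffAt_iff ?_
  filter_upwards [(isOpen_extChartAt_source (I := I) x₀).mem_nhds hx] with y hy
  exact (formInChart_extChartAt I α x₀ hy).symm

/-- The expression of a vector field in a chart. -/
noncomputable def fieldInChart (X : ∀ x : M, TangentSpace I x) (x₀ : M) (y : E) : E :=
  chartDeriv I x₀ ((extChartAt I x₀).symm y) (X ((extChartAt I x₀).symm y))

/-- A vector field is smooth at a point if and only if its expression in a chart is. -/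
theorem contMDiffAt_field_iff (X : ∀ x : M, TangentSpace I x) (x₀ : M) {x : M}
    (hx : x ∈ (extChartAt I x₀).source) :
    ContMDiffAt I I.tangent ∞ (fun x => (⟨x, X x⟩ : TangentBundle I M)) x ↔
      ContDiffAt ℝ ∞ (fieldInChart I X x₀) (extChartAt I x₀ x) := by
  have hb : x ∈ (trivializationAt E (TangentSpace I : M → Type _) x₀).baseSet := by
    simpa using hx
  rw [Trivialization.contMDiffAt_section_iff _ hb,
    contDiffAt_iff_contMDiffAt_comp_extChartAt I x₀ hx]
  refine Filter.EventuallyEq.contMDiffAt_iff ?_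
  filter_upwards [(isOpen_extChartAt_source (I := I) x₀).mem_nhds hx] with y hy
  rw [tangent_trivializationAt_apply I x₀ _ hy]
  exact congrArg (fun z => chartDeriv I x₀ z (X z)) ((extChartAt I x₀).left_inv hy).symm

end Charts

section Naturality

variable {E : Type*} [NormedAddCommGroup E] [NormedSpace ℝ E]
  {H : Type*} [TopologicalSpace H] (I : ModelWithCorners ℝ E H)
  {M : Type*} [TopologicalSpace M] [ChartedSpace H M] [I.Boundaryless]
  {E' : Type*} [NormedAddCommGroup E'] [NormedSpace ℝ E']
  {H' : Type*} [TopologicalSpace H'] (J : ModelWithCorners ℝ E' H')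
  {N : Type*} [TopologicalSpace N] [ChartedSpace H' N] [J.Boundaryless]

/-- The pullback of a 1-form. -/
noncomputable def pullbackForm (f : M → N) (α : ∀ z : N, CotangentSpace J z) (x : M) :
    CotangentSpace I x :=
  (α (f x)).comp (mfderiv I J f x)

/-- The derivative of a map of manifolds, as a map of the model spaces. -/
noncomputable def modelDeriv (f : M → N) (x : M) : E →L[ℝ] E' := mfderiv I J f x

/-- The exterior derivative of a 1-form, as a bilinear form on the model space. -/
noncomputable def extD (α : ∀ x : M, CotangentSpace I x) (x : M) : E →L[ℝ] E →L[ℝ] ℝ :=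
  extDerivOneForm I α x

theorem extDerivOneForm_congr {α β : ∀ x : M, CotangentSpace I x} {x : M}
    (h : ∀ᶠ z in 𝓝 x, α z = β z) : extDerivOneForm I α x = extDerivOneForm I β x := by
  have : formInChart I α x =ᶠ[𝓝 (extChartAt I x x)] formInChart I β x := by
    have := (continuousAt_extChartAt_symm (I := I) x).eventually
      (by rwa [(extChartAt I x).left_inv (mem_extChartAt_source x)])
    filter_upwards [this] with y hy
    rw [formInChart, formInChart, hy]
  simp only [extDerivOneForm, ModelWithCorners.range_eq_univ, fderivWithin_univ, this.fderiv_eq]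

variable [IsManifold I ∞ M] [IsManifold J ∞ N]

theorem extD_apply (α : ∀ x : M, CotangentSpace I x) (x : M) (u v : E) :
    extD I α x u v =
      fderiv ℝ (formInChart I α x) (extChartAt I x x) u v -
        fderiv ℝ (formInChart I α x) (extChartAt I x x) v u := by
  have h : extD I α x =
      (ContinuousLinearMap.precomp ℝ (chartDeriv I x x)).comp
        ((fderivWithin ℝ (formInChart I α x) (range I) (extChartAt I x x) -
          (fderivWithin ℝ (formInChart I α x) (range I) (extChartAt I x x)).flip).comp
            (chartDeriv I x x)) := rfl
  rw [h, chartDeriv_self, ModelWithCorners.range_eq_univ, fderivWithin_univ]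
  simp

omit [J.Boundaryless] in
theorem fderiv_writtenInExtChartAt {f : M → N} {x : M} {y : E} {z : N}
    (hy : y ∈ (extChartAt I x).target)
    (hf : MDifferentiableAt I J f ((extChartAt I x).symm y))
    (hz : f ((extChartAt I x).symm y) ∈ (extChartAt J z).source) (v : E) :
    fderiv ℝ (extChartAt J z ∘ f ∘ (extChartAt I x).symm) y v =
      chartDeriv J z (f ((extChartAt I x).symm y))
        (modelDeriv I J f ((extChartAt I x).symm y) (chartSymmDeriv I x y v)) := by
  have h1 : IsManifold I 1 M := .of_le (n := ∞) (by simp)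
  have h2 : IsManifold J 1 N := .of_le (n := ∞) (by simp)
  have hs : MDifferentiableAt 𝓘(ℝ, E) I (extChartAt I x).symm y :=
    (mdifferentiableOn_extChartAt_symm (I := I) y hy).mdifferentiableAt
      ((isOpen_extChartAt_target x).mem_nhds hy)
  have hc : MDifferentiableAt J 𝓘(ℝ, E') (extChartAt J z) (f ((extChartAt I x).symm y)) :=
    mdifferentiableAt_extChartAt (by rwa [extChartAt_source] at hz)
  rw [← mfderiv_eq_fderiv, mfderiv_comp y hc (hf.comp y hs), mfderiv_comp y hf hs,
    chartSymmDeriv, ModelWithCorners.range_eq_univ, mfderivWithin_univ]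
  rfl

omit [J.Boundaryless] in
theorem formInChart_pullbackForm {f : M → N} {x : M} {y : E} {z : N}
    (hy : y ∈ (extChartAt I x).target)
    (hf : MDifferentiableAt I J f ((extChartAt I x).symm y))
    (hz : f ((extChartAt I x).symm y) ∈ (extChartAt J z).source)
    (α : ∀ z : N, CotangentSpace J z) :
    formInChart I (pullbackForm I J f α) x y =
      (formInChart J α z (extChartAt J z (f ((extChartAt I x).symm y)))).comp
        (fderiv ℝ (extChartAt J z ∘ f ∘ (extChartAt I x).symm) y) := by
  ext v
  rw [ContinuousLinearMap.comp_apply, fderiv_writtenInExtChartAt I J hy hf hz,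
    ← apply_eq_formInChart J α z hz]
  rfl

omit [J.Boundaryless] in
theorem eventually_formInChart_pullbackForm {f : M → N} {x : M} (hf : ContMDiffAt I J ∞ f x)
    (α : ∀ z : N, CotangentSpace J z) :
    formInChart I (pullbackForm I J f α) x =ᶠ[𝓝 (extChartAt I x x)] fun y =>
      (formInChart J α (f x) ((extChartAt J (f x) ∘ f ∘ (extChartAt I x).symm) y)).comp
        (fderiv ℝ (extChartAt J (f x) ∘ f ∘ (extChartAt I x).symm) y) := by
  have h1 : IsManifold I 1 M := .of_le (n := ∞) (by simp)
  have h2 : IsManifold J 1 N := .of_le (n := ∞) (by simp)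
  have e1 : ∀ᶠ z in 𝓝 x, ContMDiffAt I J 1 f z :=
    (contMDiffAt_iff_contMDiffAt_nhds (by simp)).1 (hf.of_le (by norm_cast))
  have e2 : ∀ᶠ z in 𝓝 x, f z ∈ (extChartAt J (f x)).source :=
    hf.continuousAt (extChartAt_source_mem_nhds (I := J) (f x))
  have := (continuousAt_extChartAt_symm (I := I) x).eventually
    (by rw [(extChartAt I x).left_inv (mem_extChartAt_source x)]; exact e1.and e2)
  filter_upwards [this, extChartAt_target_mem_nhds (I := I) x] with y hy hyt
  exact formInChart_pullbackForm I J hyt (hy.1.mdifferentiableAt (by simp)) hy.2 α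

/-- The exterior derivative commutes with pullbacks. -/
theorem extD_pullbackForm {f : M → N} {x : M} (hf : ContMDiffAt I J ∞ f x)
    (α : ∀ z : N, CotangentSpace J z)
    (hα : DifferentiableAt ℝ (formInChart J α (f x)) (extChartAt J (f x) (f x))) (u v : E) :
    extD I (pullbackForm I J f α) x u v =
      extD J α (f x) (modelDeriv I J f x u) (modelDeriv I J f x v) := by
  set g := extChartAt J (f x) ∘ f ∘ (extChartAt I x).symm with hg
  set y := extChartAt I x x with hy
  have hx : (extChartAt I x).symm y = x := (extChartAt I x).left_inv (mem_extChartAt_source x)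
  have hgy : g y = extChartAt J (f x) (f x) := by simp only [hg, Function.comp, hx]
  have hgs : ContDiffAt ℝ ∞ g y := by
    have := (contMDiffAt_iff.1 hf).2
    rwa [ModelWithCorners.range_eq_univ, contDiffWithinAt_univ] at this
  have hdf : ∀ w : E, fderiv ℝ g y w = modelDeriv I J f x w := by
    intro w
    have h := fderiv_writtenInExtChartAt I J (mem_extChartAt_target x)
      (by rw [hx]; exact hf.mdifferentiableAt (by simp))
      (by rw [hx]; exact mem_extChartAt_source (f x)) w
    have h' : chartSymmDeriv I x y w = w := by
      have := chartSymmDeriv_chartDeriv I x (mem_extChartAt_source x) w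
      rwa [chartDeriv_self] at this
    rwa [h', hx, chartDeriv_self] at h
  have hsymm : IsSymmSndFDerivAt ℝ g y := hgs.isSymmSndFDerivAt (by simp; norm_cast)
  have hg2 : DifferentiableAt ℝ (fderiv ℝ g) y :=
    (hgs.fderiv_right (m := 1) (by norm_cast)).differentiableAt (by simp)
  rw [← hgy] at hα
  have hD : ∀ a b : E, fderiv ℝ (formInChart I (pullbackForm I J f α) x) y a b =
      fderiv ℝ (formInChart J α (f x)) (g y) (fderiv ℝ g y a) (fderiv ℝ g y b) +
        formInChart J α (f x) (g y) (fderiv ℝ (fderiv ℝ g) y a b) := by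
    intro a b
    rw [(eventually_formInChart_pullbackForm I J hf α).fderiv_eq]
    have hc := (hα.hasFDerivAt.comp y (hgs.differentiableAt (by simp)).hasFDerivAt).clm_comp
      hg2.hasFDerivAt
    rw [show (fun y => (formInChart J α (f x) (g y)).comp (fderiv ℝ g y)) = fun y =>
      ((formInChart J α (f x) ∘ g) y).comp (fderiv ℝ g y) from rfl, hc.fderiv]
    simp [add_comm]
  rw [extD_apply, extD_apply, ← hy, hD, hD, hsymm.eq, ← hgy,
    hdf, hdf]
  abel

end Naturality

section Calculus

variable {E : Type*} [NormedAddCommGroup E] [NormedSpace ℝ E]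
  {H : Type*} [TopologicalSpace H] (I : ModelWithCorners ℝ E H)
  {M : Type*} [TopologicalSpace M] [ChartedSpace H M] [I.Boundaryless]

theorem formInChart_modelSpace (β : ∀ y : E, CotangentSpace 𝓘(ℝ, E) y) (y : E) :
    formInChart 𝓘(ℝ, E) β y = (β : E → E →L[ℝ] ℝ) := by
  ext z v
  rw [formInChart_apply]
  have : chartSymmDeriv 𝓘(ℝ, E) y z v = v := by
    rw [chartSymmDeriv, ModelWithCorners.range_eq_univ, mfderivWithin_univ,
      extChartAt_model_space_eq_id]
    exact congr($(mfderiv_id) v)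
  rw [this]
  rfl

variable [IsManifold I ∞ M]

/-- The exterior derivative at a point of the domain of a chart, computed in that chart. -/
theorem extD_eq_fderiv_formInChart (α : ∀ x : M, CotangentSpace I x) (x₀ : M) {x : M}
    (hx : x ∈ (extChartAt I x₀).source)
    (hα : DifferentiableAt ℝ (formInChart I α x₀) (extChartAt I x₀ x)) (u v : E) :
    extD I α x u v =
      fderiv ℝ (formInChart I α x₀) (extChartAt I x₀ x)
          (chartDeriv I x₀ x u) (chartDeriv I x₀ x v) -
        fderiv ℝ (formInChart I α x₀) (extChartAt I x₀ x)
          (chartDeriv I x₀ x v) (chartDeriv I x₀ x u) := by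
  obtain ⟨β, hβ⟩ : ∃ β : ∀ y : E, CotangentSpace 𝓘(ℝ, E) y, β = formInChart I α x₀ := ⟨_, rfl⟩
  have h1 : extD I α x = extD I (pullbackForm I 𝓘(ℝ, E) (extChartAt I x₀) β) x := by
    refine extDerivOneForm_congr I ?_
    filter_upwards [(isOpen_extChartAt_source (I := I) x₀).mem_nhds hx] with z hz
    ext w
    rw [hβ]
    exact apply_eq_formInChart I α x₀ hz w
  have hf : ContMDiffAt I 𝓘(ℝ, E) ∞ (extChartAt I x₀) x :=
    contMDiffAt_extChartAt' (by rwa [extChartAt_source] at hx)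
  rw [h1, extD_pullbackForm I 𝓘(ℝ, E) hf _ (by rw [formInChart_modelSpace, hβ]; exact hα), extD_apply,
    formInChart_modelSpace, hβ]
  rfl

theorem mfderiv_eq_fderiv_comp_symm (f : M → ℝ) (x₀ : M) {x : M}
    (hx : x ∈ (extChartAt I x₀).source) (hf : MDifferentiableAt I 𝓘(ℝ, ℝ) f x) (v : E) :
    modelDeriv I 𝓘(ℝ, ℝ) f x v =
      fderiv ℝ (f ∘ (extChartAt I x₀).symm) (extChartAt I x₀ x) (chartDeriv I x₀ x v) := by
  have hx' := (extChartAt I x₀).left_inv hx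
  have h := fderiv_writtenInExtChartAt I 𝓘(ℝ, ℝ) (f := f) (x := x₀) (z := (0 : ℝ))
    ((extChartAt I x₀).map_source hx) (by rwa [hx'])
    (by rw [extChartAt_model_space_eq_id]; trivial) (chartDeriv I x₀ x v)
  rw [chartSymmDeriv_chartDeriv I x₀ hx, hx'] at h
  have h2 : ∀ t : ℝ, chartDeriv 𝓘(ℝ, ℝ) (0 : ℝ) t = ContinuousLinearMap.id ℝ ℝ := by
    intro t
    rw [chartDeriv, extChartAt_model_space_eq_id]
    exact mfderiv_id
  rw [h2] at h
  exact h.symm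

omit [I.Boundaryless] [IsManifold I ∞ M] in
theorem formInChart_smul (f : M → ℝ) (α : ∀ x : M, CotangentSpace I x) (x₀ : M) :
    formInChart I (fun x => f x • α x) x₀ =
      fun y => (f ∘ (extChartAt I x₀).symm) y • formInChart I α x₀ y := rfl

/-- The Leibniz rule `d (f α) = df ∧ α + f dα`. -/
theorem extD_smul {f : M → ℝ} {α : ∀ x : M, CotangentSpace I x} {x : M}
    (hf : ContMDiffAt I 𝓘(ℝ, ℝ) ∞ f x)
    (hα : DifferentiableAt ℝ (formInChart I α x) (extChartAt I x x)) (u v : E) :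
    extD I (fun x => f x • α x) x u v =
      modelDeriv I 𝓘(ℝ, ℝ) f x u * α x v - modelDeriv I 𝓘(ℝ, ℝ) f x v * α x u +
        f x * extD I α x u v := by
  have hfc : DifferentiableAt ℝ (f ∘ (extChartAt I x).symm) (extChartAt I x x) :=
    ((contMDiffAt_iff_comp_extChartAt_symm I x (mem_extChartAt_source x) f).1 hf).differentiableAt
      (by simp)
  have hx := (extChartAt I x).left_inv (mem_extChartAt_source (I := I) x)
  have hD := (hfc.hasFDerivAt.smul hα.hasFDerivAt).fderiv
  have hd : ∀ w : E, modelDeriv I 𝓘(ℝ, ℝ) f x w =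
      fderiv ℝ (f ∘ (extChartAt I x).symm) (extChartAt I x x) w := by
    intro w
    rw [mfderiv_eq_fderiv_comp_symm I f x (mem_extChartAt_source x)
      (hf.mdifferentiableAt (by simp)), chartDeriv_self]
    rfl
  have ha : ∀ w : E, α x w = formInChart I α x (extChartAt I x x) w := by
    intro w
    rw [apply_eq_formInChart I α x (mem_extChartAt_source x), chartDeriv_self]
    rfl
  rw [extD_apply, extD_apply, formInChart_smul, ha, ha, hd, hd]
  change fderiv ℝ ((f ∘ (extChartAt I x).symm) • formInChart I α x) _ u v -
    fderiv ℝ ((f ∘ (extChartAt I x).symm) • formInChart I α x) _ v u = _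
  rw [hD]
  simp only [Function.comp, hx, add_apply, ContinuousLinearMap.smulRight_apply, smul_apply,
    smul_eq_mul]
  ring

end Calculus

section Liouville

variable {E : Type*} [NormedAddCommGroup E] [NormedSpace ℝ E]
  {H : Type*} [TopologicalSpace H] (I : ModelWithCorners ℝ E H)
  {M : Type*} [TopologicalSpace M] [ChartedSpace H M] [I.Boundaryless] [IsManifold I ∞ M]

/-- The Liouville form is `p dq` in canonical coordinates. -/
theorem formInChart_liouvilleForm (q : CotangentBundle I M) {z : E × (E →L[ℝ] ℝ)}
    (hz : z ∈ (extChartAt (I.prod 𝓘(ℝ, E →L[ℝ] ℝ)) q).target) :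
    formInChart (I.prod 𝓘(ℝ, E →L[ℝ] ℝ)) (liouvilleForm I (M := M)) q z =
      z.2.comp (ContinuousLinearMap.fst ℝ E (E →L[ℝ] ℝ)) := by
  set J := I.prod 𝓘(ℝ, E →L[ℝ] ℝ) with hJ
  set q' : CotangentBundle I M := (extChartAt J q).symm z with hq'
  have hq's : q' ∈ (extChartAt J q).source := (extChartAt J q).map_target hz
  have hz' : extChartAt J q q' = z := (extChartAt J q).right_inv hz
  have hz1 : extChartAt I q.proj q'.proj = z.1 ∧
      (trivializationAt (E →L[ℝ] ℝ) (fun x : M => TangentSpace I x →L[ℝ] ℝ) q.proj q').2 = z.2 := by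
    rw [FiberBundle.extChartAt] at hz'
    exact ⟨congrArg Prod.fst hz', congrArg Prod.snd hz'⟩
  have hsrc : ∀ p ∈ (extChartAt J q).source, p.proj ∈ (extChartAt I q.proj).source := by
    intro p hp
    rw [FiberBundle.extChartAt] at hp
    exact hp.2.1
  have hz1t : z.1 ∈ (extChartAt I q.proj).target := by
    rw [← hz1.1]
    exact (extChartAt I q.proj).map_source (hsrc q' hq's)
  have hproj : (fun p : E × (E →L[ℝ] ℝ) => ((extChartAt J q).symm p).proj) =ᶠ[𝓝 z]
      fun p => (extChartAt I q.proj).symm p.1 := by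
    filter_upwards [(isOpen_extChartAt_target (I := J) q).mem_nhds hz] with p hp
    have h1 : extChartAt J q ((extChartAt J q).symm p) = p := (extChartAt J q).right_inv hp
    have h2 := hsrc _ ((extChartAt J q).map_target hp)
    rw [FiberBundle.extChartAt] at h1
    have h3 : extChartAt I q.proj ((extChartAt J q).symm p).proj = p.1 := by
      rw [FiberBundle.extChartAt]
      exact congrArg Prod.fst h1
    rw [← h3, (extChartAt I q.proj).left_inv h2]
  have i1 : IsManifold I 1 M := .of_le (n := ∞) (by simp)
  have i2 : IsManifold J 1 (CotangentBundle I M) := .of_le (n := ∞) (by simp)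
  have hχ : MDifferentiableAt 𝓘(ℝ, E × (E →L[ℝ] ℝ)) J (extChartAt J q).symm z :=
    (mdifferentiableOn_extChartAt_symm (I := J) z hz).mdifferentiableAt
      ((isOpen_extChartAt_target q).mem_nhds hz)
  have hπ : MDifferentiableAt J I (fun p : CotangentBundle I M => p.proj) q' :=
    (contMDiff_proj (n := ∞) (IB := I) (fun x : M => TangentSpace I x →L[ℝ] ℝ)).mdifferentiable
      (by simp) q'
  have hψ : MDifferentiableAt 𝓘(ℝ, E) I (extChartAt I q.proj).symm z.1 :=
    (mdifferentiableOn_extChartAt_symm (I := I) z.1 hz1t).mdifferentiableAt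
      ((isOpen_extChartAt_target q.proj).mem_nhds hz1t)
  have hfst : MDifferentiableAt 𝓘(ℝ, E × (E →L[ℝ] ℝ)) 𝓘(ℝ, E) Prod.fst z :=
    (differentiableAt_fst).mdifferentiableAt
  have hcomp : ∀ w : E × (E →L[ℝ] ℝ),
      modelDeriv J I (fun p : CotangentBundle I M => p.proj) q' (chartSymmDeriv J q z w) =
        chartSymmDeriv I q.proj z.1 w.1 := by
    intro w
    have e1 := mfderiv_comp z hπ hχ
    have e2 := mfderiv_comp z hψ hfst
    have e3 := hproj.mfderiv_eq (I := 𝓘(ℝ, E × (E →L[ℝ] ℝ))) (I' := I)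
    have e4 : modelDeriv 𝓘(ℝ, E × (E →L[ℝ] ℝ)) 𝓘(ℝ, E) Prod.fst z w = w.1 := by
      rw [modelDeriv, mfderiv_eq_fderiv, fderiv_fst]
      rfl
    have e5 : modelDeriv 𝓘(ℝ, E × (E →L[ℝ] ℝ)) I
        ((fun p : CotangentBundle I M => p.proj) ∘ (extChartAt J q).symm) z w =
        modelDeriv 𝓘(ℝ, E × (E →L[ℝ] ℝ)) I ((extChartAt I q.proj).symm ∘ Prod.fst) z w :=
      congr($e3 w)
    have e6 : modelDeriv 𝓘(ℝ, E × (E →L[ℝ] ℝ)) I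
        ((fun p : CotangentBundle I M => p.proj) ∘ (extChartAt J q).symm) z w =
        modelDeriv J I (fun p : CotangentBundle I M => p.proj) q' (chartSymmDeriv J q z w) := by
      rw [chartSymmDeriv, ModelWithCorners.range_eq_univ, mfderivWithin_univ]
      exact congr($e1 w)
    have e7 : modelDeriv 𝓘(ℝ, E × (E →L[ℝ] ℝ)) I ((extChartAt I q.proj).symm ∘ Prod.fst) z w =
        chartSymmDeriv I q.proj z.1
          (modelDeriv 𝓘(ℝ, E × (E →L[ℝ] ℝ)) 𝓘(ℝ, E) Prod.fst z w) := by
      rw [chartSymmDeriv, ModelWithCorners.range_eq_univ, mfderivWithin_univ]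
      exact congr($e2 w)
    rw [← e6, e5, e7, e4]
  refine ContinuousLinearMap.ext fun w => ?_
  have h1 := cotangent_trivializationAt_apply I q.proj q' (hsrc q' hq's) w.1
  rw [hz1.1, hz1.2] at h1
  refine Eq.trans ?_ h1.symm
  rw [← hcomp]
  rfl

theorem differentiableAt_formInChart_liouvilleForm (q : CotangentBundle I M) :
    DifferentiableAt ℝ (formInChart (I.prod 𝓘(ℝ, E →L[ℝ] ℝ)) (liouvilleForm I (M := M)) q)
      (extChartAt (I.prod 𝓘(ℝ, E →L[ℝ] ℝ)) q q) := by
  have h : (formInChart (I.prod 𝓘(ℝ, E →L[ℝ] ℝ)) (liouvilleForm I (M := M)) q)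
      =ᶠ[𝓝 (extChartAt (I.prod 𝓘(ℝ, E →L[ℝ] ℝ)) q q)] fun z : E × (E →L[ℝ] ℝ) =>
        z.2.comp (ContinuousLinearMap.fst ℝ E (E →L[ℝ] ℝ)) := by
    filter_upwards [extChartAt_target_mem_nhds (I := I.prod 𝓘(ℝ, E →L[ℝ] ℝ)) q] with z hz
    exact formInChart_liouvilleForm I q hz
  refine DifferentiableAt.congr_of_eventuallyEq ?_ h
  fun_prop

end Liouville

section Cone

variable {E : Type*} [NormedAddCommGroup E] [NormedSpace ℝ E]
  {H : Type*} [TopologicalSpace H] (I : ModelWithCorners ℝ E H)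
  {M : Type*} [TopologicalSpace M] [ChartedSpace H M] [I.Boundaryless] [IsManifold I ∞ M]

/-- The bilinear form `dη + dt ∧ η` on `A = TM ⊕ ℝ ∂_t`. -/
noncomputable def contactForm (η : ∀ x : M, CotangentSpace I x) (x : M) :
    E × ℝ →L[ℝ] E × ℝ →L[ℝ] ℝ :=
  let η' : E × ℝ →L[ℝ] ℝ := ContinuousLinearMap.comp (show E →L[ℝ] ℝ from η x) (.fst ℝ E ℝ)
  (ContinuousLinearMap.precomp ℝ (.fst ℝ E ℝ)).comp ((extD I η x).comp (.fst ℝ E ℝ)) +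
    (ContinuousLinearMap.snd ℝ E ℝ).smulRight η' -
    η'.smulRight (ContinuousLinearMap.snd ℝ E ℝ)

omit [I.Boundaryless] [IsManifold I ∞ M] in
theorem contactForm_apply (η : ∀ x : M, CotangentSpace I x) (x : M) (u v : E × ℝ) :
    contactForm I η x u v = extD I η x u.1 v.1 + u.2 * η x v.1 - η x u.1 * v.2 := by
  rfl

omit [I.Boundaryless] in
theorem cotangent_trivializationAt_smul (x₀ x : M) (hx : x ∈ (extChartAt I x₀).source)
    (c : ℝ) (p : CotangentSpace I x) :
    (trivializationAt (E →L[ℝ] ℝ) (fun x : M => TangentSpace I x →L[ℝ] ℝ) x₀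
      (covectorPoint I x (c • p))).2 =
    c • (trivializationAt (E →L[ℝ] ℝ) (fun x : M => TangentSpace I x →L[ℝ] ℝ) x₀
      (covectorPoint I x p)).2 := by
  ext v
  rw [cotangent_trivializationAt_apply I x₀ _ hx, smul_apply,
    cotangent_trivializationAt_apply I x₀ _ hx]
  rfl

variable {η : ∀ x : M, CotangentSpace I x}

omit [I.Boundaryless] in
theorem contMDiff_coneMap (hη : SmoothFormOn I η univ) :
    ContMDiff (I.prod 𝓘(ℝ, ℝ)) (I.prod 𝓘(ℝ, E →L[ℝ] ℝ)) ∞ (coneMap I η) := by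
  intro p
  rw [Bundle.contMDiffAt_totalSpace]
  refine ⟨contMDiffAt_fst, ?_⟩
  have h1 := (Bundle.contMDiffAt_section p.1).1 ((hη p.1 (mem_univ _)).contMDiffAt Filter.univ_mem)
  have h2 : ContMDiffAt (I.prod 𝓘(ℝ, ℝ)) 𝓘(ℝ, ℝ) ∞ (fun q : M × ℝ => Real.exp q.2) p :=
    Real.contDiff_exp.contMDiff.contMDiffAt.comp p contMDiffAt_snd
  refine (h2.smul (h1.comp p contMDiffAt_fst)).congr_of_eventuallyEq ?_
  have : ∀ᶠ q : M × ℝ in 𝓝 p, q.1 ∈ (extChartAt I p.1).source :=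
    continuous_fst.continuousAt.eventually (extChartAt_source_mem_nhds (I := I) p.1)
  filter_upwards [this] with q hq
  exact cotangent_trivializationAt_smul I p.1 q.1 hq _ _

omit [I.Boundaryless] in
theorem pullbackForm_coneMap (hη : SmoothFormOn I η univ) :
    pullbackForm (I.prod 𝓘(ℝ, ℝ)) (I.prod 𝓘(ℝ, E →L[ℝ] ℝ)) (coneMap I η)
      (liouvilleForm I (M := M)) =
    fun p : M × ℝ => Real.exp p.2 • pullbackForm (I.prod 𝓘(ℝ, ℝ)) I Prod.fst η p := by
  funext p
  have hπ : MDifferentiableAt (I.prod 𝓘(ℝ, E →L[ℝ] ℝ)) I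
      (fun p : CotangentBundle I M => p.proj) (coneMap I η p) :=
    (contMDiff_proj (n := ∞) (IB := I) (fun x : M => TangentSpace I x →L[ℝ] ℝ)).mdifferentiable
      (by simp) _
  have h := mfderiv_comp p hπ ((contMDiff_coneMap I hη).mdifferentiable (by simp) p)
  ext w
  change Real.exp p.2 * _ = Real.exp p.2 * _
  exact congrArg (fun z => Real.exp p.2 * (show E →L[ℝ] ℝ from η p.1) z) congr($h w).symm

omit [I.Boundaryless] [IsManifold I ∞ M] in
theorem modelDeriv_fst (p : M × ℝ) :
    modelDeriv (I.prod 𝓘(ℝ, ℝ)) I (Prod.fst : M × ℝ → M) p = ContinuousLinearMap.fst ℝ E ℝ :=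
  mfderiv_fst

omit [I.Boundaryless] [IsManifold I ∞ M] in
theorem modelDeriv_exp_snd (p : M × ℝ) (u : E × ℝ) :
    modelDeriv (I.prod 𝓘(ℝ, ℝ)) 𝓘(ℝ, ℝ) (fun q : M × ℝ => Real.exp q.2) p u =
      Real.exp p.2 * u.2 := by
  have h := mfderiv_comp (I := I.prod 𝓘(ℝ, ℝ)) (I' := 𝓘(ℝ, ℝ)) (I'' := 𝓘(ℝ, ℝ)) p
    (Real.differentiableAt_exp (x := p.2)).mdifferentiableAt
    (mdifferentiableAt_snd (I := I) (I' := 𝓘(ℝ, ℝ)))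
  have h2 : modelDeriv (I.prod 𝓘(ℝ, ℝ)) 𝓘(ℝ, ℝ) (Prod.snd : M × ℝ → ℝ) p =
    ContinuousLinearMap.snd ℝ E ℝ := mfderiv_snd
  have h3 : modelDeriv (I.prod 𝓘(ℝ, ℝ)) 𝓘(ℝ, ℝ) (fun q : M × ℝ => Real.exp q.2) p =
      (modelDeriv 𝓘(ℝ, ℝ) 𝓘(ℝ, ℝ) Real.exp p.2).comp
        (modelDeriv (I.prod 𝓘(ℝ, ℝ)) 𝓘(ℝ, ℝ) (Prod.snd : M × ℝ → ℝ) p) := h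
  have h4 : modelDeriv 𝓘(ℝ, ℝ) 𝓘(ℝ, ℝ) Real.exp p.2 = fderiv ℝ Real.exp p.2 := mfderiv_eq_fderiv
  rw [h3, h2, h4, ContinuousLinearMap.comp_apply, fderiv_eq_smul_deriv, Real.deriv_exp]
  simp [mul_comm]

/-- Smooth forms have differentiable expressions in charts. -/
theorem differentiableAt_formInChart {U : Set M} (hU : IsOpen U) (hη : SmoothFormOn I η U)
    {x : M} (hxU : x ∈ U) (x₀ : M) (hx : x ∈ (extChartAt I x₀).source) :
    DifferentiableAt ℝ (formInChart I η x₀) (extChartAt I x₀ x) :=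
  ((contMDiffAt_form_iff I η x₀ hx).1 ((hη x hxU).contMDiffAt (hU.mem_nhds hxU))).differentiableAt
    (by simp)

theorem differentiableAt_formInChart_pullbackForm_fst (hη : SmoothFormOn I η univ) (p : M × ℝ) :
    DifferentiableAt ℝ (formInChart (I.prod 𝓘(ℝ, ℝ))
      (pullbackForm (I.prod 𝓘(ℝ, ℝ)) I Prod.fst η) p) (extChartAt (I.prod 𝓘(ℝ, ℝ)) p p) := by
  have h := eventually_formInChart_pullbackForm (I.prod 𝓘(ℝ, ℝ)) I
    (f := (Prod.fst : M × ℝ → M)) (x := p) contMDiffAt_fst η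
  refine DifferentiableAt.congr_of_eventuallyEq ?_ h
  set g := extChartAt I p.1 ∘ (Prod.fst : M × ℝ → M) ∘ (extChartAt (I.prod 𝓘(ℝ, ℝ)) p).symm
    with hg
  have hgs : ContDiffAt ℝ ∞ g (extChartAt (I.prod 𝓘(ℝ, ℝ)) p p) := by
    have := (contMDiffAt_iff.1 (contMDiffAt_fst (I := I) (J := 𝓘(ℝ, ℝ)) (n := ∞) (p := p))).2
    rwa [ModelWithCorners.range_eq_univ, contDiffWithinAt_univ] at this
  have hgy : g (extChartAt (I.prod 𝓘(ℝ, ℝ)) p p) = extChartAt I p.1 p.1 := by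
    simp only [hg, Function.comp]
    rw [(extChartAt (I.prod 𝓘(ℝ, ℝ)) p).left_inv (mem_extChartAt_source p)]
  have h1 := differentiableAt_formInChart I isOpen_univ hη (mem_univ p.1) p.1
    (mem_extChartAt_source p.1)
  rw [← hgy] at h1
  exact (h1.comp _ (hgs.differentiableAt (by simp))).clm_comp
    ((hgs.fderiv_right (m := 1) (by norm_cast)).differentiableAt (by simp))

/-- The symplectic form of the cone is `e^s (dη + ds ∧ η)`. -/
theorem coneForm_eq (hη : SmoothFormOn I η univ) (p : M × ℝ) :
    coneForm I η p = Real.exp p.2 • contactForm I η p.1 := by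
  have key : ∀ u v : E × ℝ, extD (I.prod 𝓘(ℝ, E →L[ℝ] ℝ)) (liouvilleForm I (M := M))
      (coneMap I η p)
      (modelDeriv (I.prod 𝓘(ℝ, ℝ)) (I.prod 𝓘(ℝ, E →L[ℝ] ℝ)) (coneMap I η) p u)
      (modelDeriv (I.prod 𝓘(ℝ, ℝ)) (I.prod 𝓘(ℝ, E →L[ℝ] ℝ)) (coneMap I η) p v) =
      Real.exp p.2 * contactForm I η p.1 u v := by
    intro u v
    have h1 : ContMDiffAt (I.prod 𝓘(ℝ, ℝ)) 𝓘(ℝ, ℝ) ∞ (fun q : M × ℝ => Real.exp q.2) p :=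
      Real.contDiff_exp.contMDiff.contMDiffAt.comp p contMDiffAt_snd
    have h2 : ∀ w : E × ℝ, (pullbackForm (I.prod 𝓘(ℝ, ℝ)) I Prod.fst η p : E × ℝ →L[ℝ] ℝ) w =
        (η p.1 : E →L[ℝ] ℝ) w.1 := fun w =>
      congrArg (fun z => (η p.1 : E →L[ℝ] ℝ) z) congr($(modelDeriv_fst I p) w)
    have h3 := extD_smul (I.prod 𝓘(ℝ, ℝ)) h1
      (differentiableAt_formInChart_pullbackForm_fst I hη p) u v
    rw [← extD_pullbackForm (I.prod 𝓘(ℝ, ℝ)) (I.prod 𝓘(ℝ, E →L[ℝ] ℝ))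
      (contMDiff_coneMap I hη p) _ (differentiableAt_formInChart_liouvilleForm I _),
      pullbackForm_coneMap I hη, h3, modelDeriv_exp_snd, modelDeriv_exp_snd,
      extD_pullbackForm (I.prod 𝓘(ℝ, ℝ)) I contMDiffAt_fst _
        (differentiableAt_formInChart I isOpen_univ hη (mem_univ p.1) p.1
          (mem_extChartAt_source p.1)), modelDeriv_fst, contactForm_apply]
    have e1 := h2 u
    have e2 := h2 v
    simp only [ContinuousLinearMap.coe_fst']
    linear_combination (Real.exp p.2 * u.2) * e2 - (Real.exp p.2 * v.2) * e1
  refine ContinuousLinearMap.ext fun u => ContinuousLinearMap.ext fun v => ?_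
  exact key u v

theorem mem_coneGraph_iff (hη : SmoothFormOn I η univ) (p : M × ℝ) (e : StdFiber I p) :
    e ∈ coneGraph I η p ↔ e.2 = Real.exp p.2 • contactForm I η p.1 e.1 := by
  rw [coneGraph, LinearMap.mem_graph_iff, coneForm_eq I hη]
  rfl

/-- The quotient map takes the graph of the symplectic form to the graph of `dη + dt ∧ η`. -/
theorem mem_coneGraph_iff_toQuotient (hη : SmoothFormOn I η univ) (p : M × ℝ) (d : StdFiber I p) :
    d ∈ coneGraph I η p ↔ (toQuotient I p d).2 = contactForm I η p.1 (toQuotient I p d).1 := by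
  rw [mem_coneGraph_iff I hη]
  obtain ⟨u, β⟩ := d
  change (show E × ℝ →L[ℝ] ℝ from β) = Real.exp p.2 • contactForm I η p.1 u ↔
    Real.exp (-p.2) • (show E × ℝ →L[ℝ] ℝ from β) = contactForm I η p.1 u
  rw [Real.exp_neg, inv_smul_eq_iff₀ (Real.exp_ne_zero _)]

theorem mem_contactDirac_iff (hη : SmoothFormOn I η univ) (x : M) (e : E1Fiber I x) :
    e ∈ contactDirac I η x ↔ e.2 = contactForm I η x e.1 := by
  have key : ∀ s : ℝ, (toQuotient I (x, s)).symm e ∈ coneGraph I η (x, s) ↔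
      e.2 = contactForm I η x e.1 := by
    intro s
    rw [mem_coneGraph_iff_toQuotient I hη, LinearEquiv.apply_symm_apply]
  simp only [contactDirac, quotientFamily, Submodule.mem_iInf, Submodule.mem_comap]
  exact ⟨fun h => (key 0).1 (h 0), fun h s => (key s).2 h⟩

theorem map_toQuotient_coneGraph (hη : SmoothFormOn I η univ) (p : M × ℝ) :
    (coneGraph I η p).map (toQuotient I p).toLinearMap = contactDirac I η p.1 := by
  ext e
  rw [mem_contactDirac_iff I hη]
  constructor
  · rintro ⟨d, hd, rfl⟩
    exact (mem_coneGraph_iff_toQuotient I hη p d).1 hd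
  · intro h
    refine ⟨(toQuotient I p).symm e, ?_, (toQuotient I p).apply_symm_apply e⟩
    refine (mem_coneGraph_iff_toQuotient I hη p _).2 ?_
    rwa [LinearEquiv.apply_symm_apply]

theorem map_shift_coneGraph (hη : SmoothFormOn I η univ) (t : ℝ) (p : M × ℝ) :
    (coneGraph I η p).map (shift I t p).toLinearMap = coneGraph I η (translate t p) := by
  have key : ∀ d, shift I t p d ∈ coneGraph I η (translate t p) ↔ d ∈ coneGraph I η p := by
    intro d
    rw [mem_coneGraph_iff_toQuotient I hη, mem_coneGraph_iff_toQuotient I hη, toQuotient_shift]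
    rfl
  ext e
  constructor
  · rintro ⟨d, hd, rfl⟩
    exact (key d).2 hd
  · intro h
    refine ⟨(shift I t p).symm e, ?_, (shift I t p).apply_symm_apply e⟩
    refine (key _).1 ?_
    rwa [LinearEquiv.apply_symm_apply]

end Cone

section Embedding

variable {E : Type*} [NormedAddCommGroup E] [NormedSpace ℝ E]
  {H : Type*} [TopologicalSpace H] (I : ModelWithCorners ℝ E H)
  {M : Type*} [TopologicalSpace M] [ChartedSpace H M] [IsManifold I ∞ M]
  {η : ∀ x : M, CotangentSpace I x}

/-- The cone map has a smooth left inverse near each point. -/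
theorem exists_leftInverse_coneMap (hη : SmoothFormOn I η univ) (hη0 : ∀ x, η x ≠ 0) (p : M × ℝ) :
    ∃ (g : CotangentBundle I M → M × ℝ) (V : Set M), V ∈ 𝓝 p.1 ∧
      ContMDiffAt (I.prod 𝓘(ℝ, E →L[ℝ] ℝ)) (I.prod 𝓘(ℝ, ℝ)) ∞ g (coneMap I η p) ∧
      (∀ q, (g q).1 = q.proj) ∧ ∀ p' : M × ℝ, p'.1 ∈ V → g (coneMap I η p') = p' := by
  set τ := trivializationAt (E →L[ℝ] ℝ) (fun x : M => TangentSpace I x →L[ℝ] ℝ) p.1 with hτ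
  have hsm : ContMDiffAt I 𝓘(ℝ, E →L[ℝ] ℝ) ∞ (fun x => (τ (covectorPoint I x (η x))).2) p.1 :=
    (Bundle.contMDiffAt_section p.1).1 ((hη p.1 (mem_univ _)).contMDiffAt Filter.univ_mem)
  have hne : (τ (covectorPoint I p.1 (η p.1))).2 ≠ 0 := by
    intro h
    rw [← formInChart_extChartAt I η p.1 (mem_extChartAt_source p.1)] at h
    refine hη0 p.1 (ContinuousLinearMap.ext fun v => ?_)
    have h2 := apply_eq_formInChart I η p.1 (mem_extChartAt_source p.1) v
    rw [h] at h2
    exact h2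
  obtain ⟨z, hz⟩ : ∃ z : E, (τ (covectorPoint I p.1 (η p.1))).2 z ≠ 0 := by
    by_contra! h
    exact hne (ContinuousLinearMap.ext h)
  have hsmz : ContMDiffAt I 𝓘(ℝ, ℝ) ∞ (fun x => (τ (covectorPoint I x (η x))).2 z) p.1 :=
    hsm.clm_apply contMDiffAt_const
  refine ⟨fun q => (q.proj, Real.log ((τ q).2 z / (τ (covectorPoint I q.proj (η q.proj))).2 z)),
    {x | x ∈ (extChartAt I p.1).source ∧ (τ (covectorPoint I x (η x))).2 z ≠ 0}, ?_, ?_,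
    fun _ => rfl, ?_⟩
  · exact Filter.inter_mem (extChartAt_source_mem_nhds p.1)
      (hsmz.continuousAt.eventually (isOpen_ne.mem_nhds hz))
  · have hid := Bundle.contMDiffAt_totalSpace.1 (contMDiffAt_id (I := I.prod 𝓘(ℝ, E →L[ℝ] ℝ))
      (n := ∞) (x := coneMap I η p))
    have h1 : ContMDiffAt (I.prod 𝓘(ℝ, E →L[ℝ] ℝ)) 𝓘(ℝ, ℝ) ∞
        (fun q : CotangentBundle I M => (τ q).2 z) (coneMap I η p) :=
      hid.2.clm_apply contMDiffAt_const
    have h2 : ContMDiffAt (I.prod 𝓘(ℝ, E →L[ℝ] ℝ)) 𝓘(ℝ, ℝ) ∞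
        (fun q : CotangentBundle I M => (τ (covectorPoint I q.proj (η q.proj))).2 z)
        (coneMap I η p) :=
      ContMDiffAt.comp (coneMap I η p) (g := fun x => (τ (covectorPoint I x (η x))).2 z) hsmz hid.1
    refine hid.1.prodMk ?_
    have hval : (τ (coneMap I η p)).2 z = Real.exp p.2 * (τ (covectorPoint I p.1 (η p.1))).2 z := by
      have := cotangent_trivializationAt_smul I p.1 p.1 (mem_extChartAt_source p.1) (Real.exp p.2)
        (η p.1)
      exact congr($this z)
    have h3 : ContDiffAt ℝ ∞ (fun a : ℝ × ℝ => Real.log (a.1 / a.2))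
        ((τ (coneMap I η p)).2 z, (τ (covectorPoint I p.1 (η p.1))).2 z) := by
      refine (contDiffAt_fst.div contDiffAt_snd hz).log ?_
      rw [hval]
      exact div_ne_zero (mul_ne_zero (Real.exp_ne_zero _) hz) hz
    exact h3.contMDiffAt.comp (coneMap I η p) (h1.prodMk_space h2)
  · rintro ⟨x, s⟩ ⟨hx, hxz⟩
    refine Prod.ext rfl ?_
    have hval : (τ (coneMap I η (x, s))).2 z = Real.exp s * (τ (covectorPoint I x (η x))).2 z := by
      have := cotangent_trivializationAt_smul I p.1 x hx (Real.exp s) (η x)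
      exact congr($this z)
    change Real.log ((τ (coneMap I η (x, s))).2 z / (τ (covectorPoint I x (η x))).2 z) = s
    rw [hval, mul_div_assoc, div_self hxz, mul_one, Real.log_exp]

theorem injective_mfderiv_coneMap (hη : SmoothFormOn I η univ) (hη0 : ∀ x, η x ≠ 0)
    (p : M × ℝ) : Function.Injective (mfderiv (I.prod 𝓘(ℝ, ℝ)) (I.prod 𝓘(ℝ, E →L[ℝ] ℝ))
      (coneMap I η) p) := by
  obtain ⟨g, V, hV, hg, -, hgl⟩ := exists_leftInverse_coneMap I hη hη0 p
  have h1 := mfderiv_comp p (hg.mdifferentiableAt (by simp))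
    ((contMDiff_coneMap I hη).mdifferentiable (by simp) p)
  have h2 : g ∘ coneMap I η =ᶠ[𝓝 p] id := by
    have : ∀ᶠ q : M × ℝ in 𝓝 p, q.1 ∈ V := continuous_fst.continuousAt.eventually hV
    filter_upwards [this] with q hq
    exact hgl q hq
  have h3 := h2.mfderiv_eq (I := I.prod 𝓘(ℝ, ℝ)) (I' := I.prod 𝓘(ℝ, ℝ))
  intro u v huv
  have h4 : ∀ w : E × ℝ, modelDeriv (I.prod 𝓘(ℝ, E →L[ℝ] ℝ)) (I.prod 𝓘(ℝ, ℝ)) g (coneMap I η p)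
      (modelDeriv (I.prod 𝓘(ℝ, ℝ)) (I.prod 𝓘(ℝ, E →L[ℝ] ℝ)) (coneMap I η) p w) = w := by
    intro w
    have h5 : modelDeriv (I.prod 𝓘(ℝ, ℝ)) (I.prod 𝓘(ℝ, ℝ)) (id : M × ℝ → M × ℝ) p w = w :=
      congr($(mfderiv_id) w)
    exact (congr($h1 w)).symm.trans ((congr($h3 w)).trans h5)
  exact (h4 u).symm.trans ((congrArg (modelDeriv (I.prod 𝓘(ℝ, E →L[ℝ] ℝ)) (I.prod 𝓘(ℝ, ℝ)) g
    (coneMap I η p)) huv).trans (h4 v))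

theorem isEmbedding_coneMap (hη : SmoothFormOn I η univ) (hη0 : ∀ x, η x ≠ 0) :
    IsEmbedding (coneMap I η) := by
  refine ⟨isInducing_iff_nhds.2 fun p => le_antisymm
    (contMDiff_coneMap I hη).continuous.continuousAt.le_comap ?_, ?_⟩
  · obtain ⟨g, V, hV, hg, hgp, hgl⟩ := exists_leftInverse_coneMap I hη hη0 p
    intro W hW
    have hgp0 : g (coneMap I η p) = p := hgl p (mem_of_mem_nhds hV)
    have hW' : {q | g q ∈ W ∧ (g q).1 ∈ V} ∈ 𝓝 (coneMap I η p) := by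
      refine hg.continuousAt (Filter.inter_mem ?_ (continuous_fst.continuousAt ?_))
      · rwa [hgp0]
      · rwa [hgp0]
    refine ⟨_, hW', ?_⟩
    rintro q ⟨h1, h2⟩
    rw [hgp] at h2
    rwa [hgl q h2] at h1
  · intro p q hpq
    obtain ⟨g, V, hV, -, -, hgl⟩ := exists_leftInverse_coneMap I hη hη0 p
    have hproj : p.1 = q.1 := congrArg TotalSpace.proj hpq
    rw [← hgl p (mem_of_mem_nhds hV), ← hgl q (hproj ▸ mem_of_mem_nhds hV), hpq]

end Embedding

section Sections

variable {E : Type*} [NormedAddCommGroup E] [NormedSpace ℝ E]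
  {H : Type*} [TopologicalSpace H] {I : ModelWithCorners ℝ E H}
  {M : Type*} [TopologicalSpace M] [ChartedSpace H M] [IsManifold I ∞ M]

namespace CoorientedDistribution

variable (ξ : CoorientedDistribution I M)

theorem convex_pos (x : M) : Convex ℝ (ξ.pos x) := by
  obtain ⟨U, -, hx, η, -, hη⟩ := ξ.locally_defined x
  rw [(hη x hx).2.2]
  rintro _ ⟨a, ha, rfl⟩ _ ⟨b, hb, rfl⟩ s t hs ht hst
  refine ⟨s * a + t * b, ?_, by simp [add_smul, mul_smul]⟩
  rcases hs.eq_or_lt with rfl | hs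
  · have : t = 1 := by linarith
    subst this
    linarith
  · have := mul_pos hs ha
    have := mul_nonneg ht hb.le
    linarith

variable {ξ} in
theorem pos_eq_of_mem {x : M} {p : CotangentSpace I x} (hp : p ∈ ξ.pos x) :
    p ≠ 0 ∧ ξ.plane x = LinearMap.ker p.toLinearMap ∧
      ξ.pos x = {q | ∃ c : ℝ, 0 < c ∧ q = c • p} := by
  obtain ⟨U, -, hx, η, -, hη⟩ := ξ.locally_defined x
  obtain ⟨h0, hpl, hpos⟩ := hη x hx
  rw [hpos] at hp
  obtain ⟨c, hc, rfl⟩ := hp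
  refine ⟨smul_ne_zero hc.ne' h0, ?_, ?_⟩
  · rw [hpl]
    ext v
    simp [hc.ne']
  · rw [hpos]
    ext q
    constructor
    · rintro ⟨d, hd, rfl⟩
      exact ⟨d / c, div_pos hd hc, by rw [smul_smul, div_mul_cancel₀ _ hc.ne']⟩
    · rintro ⟨d, hd, rfl⟩
      exact ⟨d * c, mul_pos hd hc, by rw [smul_smul]⟩

theorem exists_isPositiveForm [FiniteDimensional ℝ E] [T2Space M] [SigmaCompactSpace M] :
    ∃ η, ξ.IsPositiveForm η := by
  obtain ⟨s, hs⟩ := exists_contMDiffSection_forall_mem_convex_of_local (n := ⊤) I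
    (F_fiber := E →L[ℝ] ℝ) (fun x : M => TangentSpace I x →L[ℝ] ℝ) ξ.pos ξ.convex_pos (by
      intro x₀
      obtain ⟨U, hU, hx, η, hηs, hη⟩ := ξ.locally_defined x₀
      refine ⟨U, hU.mem_nhds hx, η, hηs, fun y hy => ?_⟩
      rw [(hη y hy).2.2]
      exact ⟨1, one_pos, (one_smul _ _).symm⟩)
  exact ⟨s, s.contMDiff.contMDiffOn, hs⟩

theorem range_coneMap {η : ∀ x : M, CotangentSpace I x} (hη : ξ.IsPositiveForm η) :
    range (coneMap I η) = ξ.annPos := by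
  ext ⟨x, p⟩
  change _ ↔ p ∈ ξ.pos x
  rw [(pos_eq_of_mem (hη.2 x)).2.2]
  constructor
  · rintro ⟨⟨y, s⟩, h⟩
    obtain rfl : y = x := congrArg TotalSpace.proj h
    exact ⟨Real.exp s, Real.exp_pos s, (TotalSpace.mk_inj.1 h).symm⟩
  · rintro ⟨c, hc, rfl⟩
    refine ⟨(x, Real.log c), ?_⟩
    simp only [coneMap, Real.exp_log hc]

omit [IsManifold I ∞ M] in
theorem coneMap_translate (η : ∀ x : M, CotangentSpace I x) (t : ℝ) (p : M × ℝ) :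
    coneMap I η (translate t p) = covectorPoint I p.1 (Real.exp t • (coneMap I η p).2) := by
  change covectorPoint I p.1 (Real.exp (p.2 + t) • η p.1) =
    covectorPoint I p.1 (Real.exp t • Real.exp p.2 • η p.1)
  rw [add_comm, Real.exp_add, mul_smul]

end CoorientedDistribution

end Sections

section VectorSpace

variable {E : Type*} [NormedAddCommGroup E] [NormedSpace ℝ E]

theorem contDiff_flip : ContDiff ℝ ∞ (fun B : E →L[ℝ] E →L[ℝ] ℝ => B.flip) :=
  IsBoundedLinearMap.contDiff (E := E →L[ℝ] E →L[ℝ] ℝ) (F := E →L[ℝ] E →L[ℝ] ℝ)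
    (IsLinearMap.with_bound ⟨fun _ _ => rfl, fun _ _ => rfl⟩ 1 fun B => by
      rw [ContinuousLinearMap.opNorm_flip, one_mul])

theorem fderiv_apply_apply {f : E → E →L[ℝ] E →L[ℝ] ℝ} {y : E} (hf : ContDiffAt ℝ ∞ f y)
    (a b c : E) : fderiv ℝ f y a b c = fderiv ℝ (fun z => f z b c) y a := by
  have hd := hf.differentiableAt (by simp)
  rw [((hd.hasFDerivAt.clm_apply (hasFDerivAt_const b y)).clm_apply
    (hasFDerivAt_const c y)).fderiv]
  simp

/-- The exterior derivative of a 1-form on a vector space. -/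
noncomputable def flatD (η : E → E →L[ℝ] ℝ) (y : E) : E →L[ℝ] E →L[ℝ] ℝ :=
  fderiv ℝ η y - (fderiv ℝ η y).flip

theorem flatD_apply (η : E → E →L[ℝ] ℝ) (y u v : E) :
    flatD η y u v = fderiv ℝ η y u v - fderiv ℝ η y v u := rfl

theorem flatD_swap (η : E → E →L[ℝ] ℝ) (y u v : E) : flatD η y u v = - flatD η y v u := by
  simp [flatD_apply]

theorem ContDiffAt.flatD {η : E → E →L[ℝ] ℝ} {y : E} (hη : ContDiffAt ℝ ∞ η y) :
    ContDiffAt ℝ ∞ (flatD η) y := by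
  have h : ContDiffAt ℝ ∞ (fderiv ℝ η) y := hη.fderiv_right (by norm_cast)
  exact h.sub (contDiff_flip.contDiffAt.comp y h)

/-- The exterior derivative of an exact 2-form vanishes. -/
theorem fderiv_flatD_cyclic {η : E → E →L[ℝ] ℝ} {y : E} (hη : ContDiffAt ℝ ∞ η y) (u v w : E) :
    fderiv ℝ (flatD η) y u v w + fderiv ℝ (flatD η) y v w u + fderiv ℝ (flatD η) y w u v = 0 := by
  have h : ContDiffAt ℝ ∞ (fderiv ℝ η) y := hη.fderiv_right (by norm_cast)
  have hs : IsSymmSndFDerivAt ℝ η y := hη.isSymmSndFDerivAt (by simp; norm_cast)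
  have key : ∀ a b c : E, fderiv ℝ (flatD η) y a b c =
      fderiv ℝ (fderiv ℝ η) y a b c - fderiv ℝ (fderiv ℝ η) y a c b := by
    intro a b c
    have h2 : ∀ b c : E, DifferentiableAt ℝ (fun z => fderiv ℝ η z b c) y := fun b c =>
      ((h.clm_apply contDiffAt_const).clm_apply contDiffAt_const).differentiableAt (by simp)
    rw [fderiv_apply_apply (ContDiffAt.flatD hη), fderiv_apply_apply h, fderiv_apply_apply h,
      ← sub_apply, ← fderiv_fun_sub (h2 b c) (h2 c b)]
    rfl
  simp only [key]
  rw [hs.eq v u, hs.eq w u, hs.eq w v]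
  abel

/-- The form `ι_X dη + f η` on a vector space, the horizontal part of `ι_{X + f ∂_t} (dη + dt ∧ η)`. -/
noncomputable def flatContact (η : E → E →L[ℝ] ℝ) (X : E → E) (f : E → ℝ) (y : E) : E →L[ℝ] ℝ :=
  flatD η y (X y) + f y • η y

theorem contDiffAt_flatContact {η : E → E →L[ℝ] ℝ} {X : E → E} {f : E → ℝ} {y : E}
    (hη : ContDiffAt ℝ ∞ η y) (hX : ContDiffAt ℝ ∞ X y) (hf : ContDiffAt ℝ ∞ f y) :
    ContDiffAt ℝ ∞ (flatContact η X f) y :=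
  ((ContDiffAt.flatD hη).clm_apply hX).add (hf.smul hη)

theorem fderiv_flatContact {η : E → E →L[ℝ] ℝ} {X : E → E} {f : E → ℝ} {y : E}
    (hη : ContDiffAt ℝ ∞ η y) (hX : ContDiffAt ℝ ∞ X y) (hf : ContDiffAt ℝ ∞ f y) (u w : E) :
    fderiv ℝ (flatContact η X f) y u w =
      fderiv ℝ (flatD η) y u (X y) w + flatD η y (fderiv ℝ X y u) w +
        fderiv ℝ f y u * η y w + f y * fderiv ℝ η y u w := by
  have h : HasFDerivAt (flatContact η X f) _ y :=
    ((((ContDiffAt.flatD hη).differentiableAt (by simp)).hasFDerivAt.clm_apply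
      (hX.differentiableAt (by simp)).hasFDerivAt).add
      ((hf.differentiableAt (by simp)).hasFDerivAt.smul
        (hη.differentiableAt (by simp)).hasFDerivAt))
  rw [h.fderiv]
  simp only [add_apply, ContinuousLinearMap.comp_apply, ContinuousLinearMap.flip_apply, smul_apply,
    ContinuousLinearMap.smulRight_apply, smul_eq_mul]
  ring

theorem fderiv_apply_field {η : E → E →L[ℝ] ℝ} {X : E → E} {y : E}
    (hη : ContDiffAt ℝ ∞ η y) (hX : ContDiffAt ℝ ∞ X y) (u : E) :
    fderiv ℝ (fun z => η z (X z)) y u = fderiv ℝ η y u (X y) + η y (fderiv ℝ X y u) := by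
  rw [((hη.differentiableAt (by simp)).hasFDerivAt.clm_apply
    (hX.differentiableAt (by simp)).hasFDerivAt).fderiv]
  simp [add_comm]

variable {η : E → E →L[ℝ] ℝ} {X Y : E → E} {f g : E → ℝ} {y : E}

/-- Involutivity of the graph of `dη + dt ∧ η` on a vector space, component in `T^*`. -/
theorem flat_involutive_horizontal (hη : ContDiffAt ℝ ∞ η y) (hX : ContDiffAt ℝ ∞ X y)
    (hY : ContDiffAt ℝ ∞ Y y) (hf : ContDiffAt ℝ ∞ f y) (hg : ContDiffAt ℝ ∞ g y) (w : E) :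
    fderiv ℝ (fun z => flatContact η Y g z (X z) - f z * η z (Y z)) y w +
        (flatD (flatContact η Y g) y (X y) w - f y * fderiv ℝ (fun z => - η z (Y z)) y w +
          f y * flatContact η Y g y w) -
        (flatD (flatContact η X f) y (Y y) w - g y * fderiv ℝ (fun z => - η z (X z)) y w +
          g y * flatContact η X f y w) =
      flatD η y (fderiv ℝ Y y (X y) - fderiv ℝ X y (Y y)) w +
        (fderiv ℝ g y (X y) - fderiv ℝ f y (Y y)) * η y w := by
  have h1 : fderiv ℝ (fun z => flatContact η Y g z (X z) - f z * η z (Y z)) y w =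
      fderiv ℝ (flatContact η Y g) y w (X y) + flatContact η Y g y (fderiv ℝ X y w) -
        (fderiv ℝ f y w * η y (Y y) +
          f y * (fderiv ℝ η y w (Y y) + η y (fderiv ℝ Y y w))) := by
    have e1 : ContDiffAt ℝ ∞ (fun z => flatContact η Y g z (X z)) y :=
      (contDiffAt_flatContact hη hY hg).clm_apply hX
    have e2 : ContDiffAt ℝ ∞ (fun z => η z (Y z)) y := hη.clm_apply hY
    have h : HasFDerivAt (fun z => flatContact η Y g z (X z) - f z * η z (Y z)) _ y :=
      (e1.differentiableAt (by simp)).hasFDerivAt.sub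
        ((hf.differentiableAt (by simp)).hasFDerivAt.mul
          (e2.differentiableAt (by simp)).hasFDerivAt)
    rw [h.fderiv]
    simp only [sub_apply, add_apply, smul_apply, smul_eq_mul,
      fderiv_apply_field (contDiffAt_flatContact hη hY hg) hX, fderiv_apply_field hη hY]
    ring
  have h2 : ∀ Z : E → E, ContDiffAt ℝ ∞ Z y → fderiv ℝ (fun z => - η z (Z z)) y w =
      -(fderiv ℝ η y w (Z y) + η y (fderiv ℝ Z y w)) := by
    intro Z hZ
    rw [← fderiv_apply_field hη hZ, fderiv_fun_neg]
    rfl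
  have hc := fderiv_flatD_cyclic hη (X y) (Y y) w
  have hs : ∀ a b c : E, fderiv ℝ (flatD η) y a b c = - fderiv ℝ (flatD η) y a c b := by
    intro a b c
    rw [fderiv_apply_apply (ContDiffAt.flatD hη), fderiv_apply_apply (ContDiffAt.flatD hη),
      ← neg_apply, ← fderiv_fun_neg]
    congr 2
    funext z
    exact flatD_swap η z b c
  have hs1 := hs (Y y) w (X y)
  rw [h1, h2 Y hY, h2 X hX, flatD_apply (flatContact η Y g), flatD_apply (flatContact η X f)]
  simp only [fderiv_flatContact hη hX hf, fderiv_flatContact hη hY hg, map_sub, sub_apply]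
  simp only [flatContact, add_apply, smul_apply, smul_eq_mul]
  simp only [flatD_apply] at *
  linear_combination hc - hs1

/-- Involutivity of the graph of `dη + dt ∧ η` on a vector space, component in `ℝ dt`. -/
theorem flat_involutive_vertical (hη : ContDiffAt ℝ ∞ η y) (hX : ContDiffAt ℝ ∞ X y)
    (hY : ContDiffAt ℝ ∞ Y y) :
    (flatContact η Y g y (X y) - f y * η y (Y y)) +
        (fderiv ℝ (fun z => - η z (Y z)) y (X y) - flatContact η Y g y (X y)) -
        (fderiv ℝ (fun z => - η z (X z)) y (Y y) - flatContact η X f y (Y y)) =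
      - η y (fderiv ℝ Y y (X y) - fderiv ℝ X y (Y y)) := by
  have h2 : ∀ (Z : E → E) (w : E), ContDiffAt ℝ ∞ Z y → fderiv ℝ (fun z => - η z (Z z)) y w =
      -(fderiv ℝ η y w (Z y) + η y (fderiv ℝ Z y w)) := by
    intro Z w hZ
    rw [← fderiv_apply_field hη hZ, fderiv_fun_neg]
    rfl
  rw [h2 Y _ hY, h2 X _ hX]
  simp only [flatContact, add_apply, smul_apply, smul_eq_mul, flatD_apply, map_sub]
  ring

end VectorSpace

section Dirac

variable {E : Type*} [NormedAddCommGroup E] [NormedSpace ℝ E]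
  {H : Type*} [TopologicalSpace H] (I : ModelWithCorners ℝ E H)
  {M : Type*} [TopologicalSpace M] [ChartedSpace H M] [I.Boundaryless] [IsManifold I ∞ M]
  {η : ∀ x : M, CotangentSpace I x}

omit [I.Boundaryless] in
theorem formInChart_apply_fieldInChart (η : ∀ x : M, CotangentSpace I x)
    (X : ∀ x : M, TangentSpace I x) (x₀ : M) {y : E} (hy : y ∈ (extChartAt I x₀).target) :
    formInChart I η x₀ y (fieldInChart I X x₀ y) =
      η ((extChartAt I x₀).symm y) (X ((extChartAt I x₀).symm y)) := by
  have h := apply_eq_formInChart I η x₀ ((extChartAt I x₀).map_target hy)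
    (X ((extChartAt I x₀).symm y))
  rw [(extChartAt I x₀).right_inv hy] at h
  exact h.symm

theorem extD_symm_eq_flatD {x₀ : M} {y : E} (hy : y ∈ (extChartAt I x₀).target)
    (hη : DifferentiableAt ℝ (formInChart I η x₀) y) (u v : E) :
    extD I η ((extChartAt I x₀).symm y) u v = flatD (formInChart I η x₀) y
      (chartDeriv I x₀ ((extChartAt I x₀).symm y) u)
      (chartDeriv I x₀ ((extChartAt I x₀).symm y) v) := by
  have hr := (extChartAt I x₀).right_inv hy
  rw [extD_eq_fderiv_formInChart I η x₀ ((extChartAt I x₀).map_target hy) (by rwa [hr]), hr]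
  rfl

variable (η) in
/-- The covector part of the section of the graph of `dη + dt ∧ η` over `X + f ∂_t`. -/
noncomputable def graphForm (X : ∀ x : M, TangentSpace I x) (f : M → ℝ) (x : M) : ADual I x :=
  contactForm I η x (X x, f x)

theorem formInChart_horizontalPart {x₀ : M} {y : E} (hy : y ∈ (extChartAt I x₀).target)
    (hη : DifferentiableAt ℝ (formInChart I η x₀) y) (X : ∀ x : M, TangentSpace I x) (f : M → ℝ) :
    formInChart I (fun x => horizontalPart I (graphForm I η X f x)) x₀ y =
      flatContact (formInChart I η x₀) (fieldInChart I X x₀) (f ∘ (extChartAt I x₀).symm) y := by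
  refine ContinuousLinearMap.ext fun w => ?_
  have h1 : formInChart I (fun x => horizontalPart I (graphForm I η X f x)) x₀ y w =
      contactForm I η ((extChartAt I x₀).symm y) (X ((extChartAt I x₀).symm y),
        f ((extChartAt I x₀).symm y)) (chartSymmDeriv I x₀ y w, 0) := rfl
  rw [h1, contactForm_apply]
  simp only [mul_zero, sub_zero]
  have h2 := extD_symm_eq_flatD I hy hη (X ((extChartAt I x₀).symm y)) (chartSymmDeriv I x₀ y w)
  rw [chartDeriv_chartSymmDeriv I x₀ hy] at h2
  rw [h2]
  rfl

omit [I.Boundaryless] in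
theorem verticalPart_graphForm {x₀ : M} {y : E} (hy : y ∈ (extChartAt I x₀).target)
    (X : ∀ x : M, TangentSpace I x) (f : M → ℝ) :
    verticalPart I (graphForm I η X f ((extChartAt I x₀).symm y)) =
      - formInChart I η x₀ y (fieldInChart I X x₀ y) := by
  rw [formInChart_apply_fieldInChart I η X x₀ hy]
  have h1 : verticalPart I (graphForm I η X f ((extChartAt I x₀).symm y)) =
      contactForm I η ((extChartAt I x₀).symm y) (X ((extChartAt I x₀).symm y),
        f ((extChartAt I x₀).symm y)) (0, 1) := rfl
  rw [h1, contactForm_apply]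
  have h2 : extD I η ((extChartAt I x₀).symm y) (X ((extChartAt I x₀).symm y)) 0 = 0 := map_zero _
  have h3 : η ((extChartAt I x₀).symm y) (0 : E) = 0 := map_zero _
  linear_combination h2 + f ((extChartAt I x₀).symm y) * h3

theorem graphForm_apply {x₀ : M} {y : E} (hy : y ∈ (extChartAt I x₀).target)
    (hη : DifferentiableAt ℝ (formInChart I η x₀) y)
    (X Y : ∀ x : M, TangentSpace I x) (f g : M → ℝ) :
    graphForm I η Y g ((extChartAt I x₀).symm y)
        (X ((extChartAt I x₀).symm y), f ((extChartAt I x₀).symm y)) =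
      flatContact (formInChart I η x₀) (fieldInChart I Y x₀) (g ∘ (extChartAt I x₀).symm) y
          (fieldInChart I X x₀ y) -
        (f ∘ (extChartAt I x₀).symm) y * formInChart I η x₀ y (fieldInChart I Y x₀ y) := by
  have h1 : graphForm I η Y g ((extChartAt I x₀).symm y)
        (X ((extChartAt I x₀).symm y), f ((extChartAt I x₀).symm y)) =
      contactForm I η ((extChartAt I x₀).symm y) (Y ((extChartAt I x₀).symm y),
        g ((extChartAt I x₀).symm y)) (X ((extChartAt I x₀).symm y),
          f ((extChartAt I x₀).symm y)) := rfl
  rw [h1, contactForm_apply]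
  have h2 := extD_symm_eq_flatD I hy hη (Y ((extChartAt I x₀).symm y))
    (X ((extChartAt I x₀).symm y))
  have h3 := formInChart_apply_fieldInChart I η X x₀ hy
  have h4 := formInChart_apply_fieldInChart I η Y x₀ hy
  simp only [flatContact, add_apply, smul_apply, smul_eq_mul, Function.comp]
  change _ = flatD (formInChart I η x₀) y
    (chartDeriv I x₀ ((extChartAt I x₀).symm y) (Y ((extChartAt I x₀).symm y)))
    (chartDeriv I x₀ ((extChartAt I x₀).symm y) (X ((extChartAt I x₀).symm y))) + _ - _
  linear_combination h2 - g ((extChartAt I x₀).symm y) * h3 + f ((extChartAt I x₀).symm y) * h4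

theorem modelDeriv_eq_of_eventuallyEq {F : M → ℝ} {F' : E → ℝ} {x : M}
    (h : F ∘ (extChartAt I x).symm =ᶠ[𝓝 (extChartAt I x x)] F')
    (hF' : ContDiffAt ℝ ∞ F' (extChartAt I x x)) (u : E) :
    modelDeriv I 𝓘(ℝ, ℝ) F x u = fderiv ℝ F' (extChartAt I x x) u := by
  have hF : ContMDiffAt I 𝓘(ℝ, ℝ) ∞ F x :=
    (contMDiffAt_iff_comp_extChartAt_symm I x (mem_extChartAt_source x) F).2
      (hF'.congr_of_eventuallyEq h)
  rw [mfderiv_eq_fderiv_comp_symm I F x (mem_extChartAt_source x) (hF.mdifferentiableAt (by simp)),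
    chartDeriv_self, h.fderiv_eq]
  rfl

theorem extD_eq_of_eventuallyEq {α : ∀ x : M, CotangentSpace I x} {α' : E → E →L[ℝ] ℝ} {x : M}
    (h : formInChart I α x =ᶠ[𝓝 (extChartAt I x x)] α') (u v : E) :
    extD I α x u v = flatD α' (extChartAt I x x) u v := by
  rw [extD_apply, h.fderiv_eq]
  rfl

omit [I.Boundaryless] in
theorem fieldInChart_self (Z : ∀ x : M, TangentSpace I x) (x : M) :
    fieldInChart I Z x (extChartAt I x x) = Z x := by
  have hx := (extChartAt I x).left_inv (mem_extChartAt_source (I := I) x)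
  have h1 : chartDeriv I x ((extChartAt I x).symm (extChartAt I x x)) =
      ContinuousLinearMap.id ℝ E := by
    rw [hx, chartDeriv_self]
  exact congr($h1 (Z ((extChartAt I x).symm (extChartAt I x x)))).trans
    (congrArg (fun z => (Z z : E)) hx)

omit [I.Boundaryless] in
theorem formInChart_self (α : ∀ x : M, CotangentSpace I x) (x : M) :
    formInChart I α x (extChartAt I x x) = (α x : E →L[ℝ] ℝ) := by
  refine ContinuousLinearMap.ext fun v => ?_
  have h := apply_eq_formInChart I α x (mem_extChartAt_source x) v
  rw [chartDeriv_self] at h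
  exact h.symm

theorem mlieBracket_eq_fieldInChart (X Y : ∀ x : M, TangentSpace I x) (x : M) :
    VectorField.mlieBracket I X Y x =
      fderiv ℝ (fieldInChart I Y x) (extChartAt I x x) (X x) -
        fderiv ℝ (fieldInChart I X x) (extChartAt I x x) (Y x) := by
  have i1 : IsManifold I 1 M := .of_le (n := ∞) (by simp)
  have key : ∀ Z : (∀ x : M, TangentSpace I x),
      VectorField.mpullbackWithin 𝓘(ℝ, E) I (extChartAt I x).symm Z (range I)
        =ᶠ[𝓝 (extChartAt I x x)] fieldInChart I Z x := by
    intro Z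
    filter_upwards [extChartAt_target_mem_nhds (I := I) x] with y hy
    have h := ContinuousLinearMap.inverse_eq
      (mfderivWithin_extChartAt_symm_comp_mfderiv_extChartAt (I := I) hy)
      (mfderiv_extChartAt_comp_mfderivWithin_extChartAt_symm hy)
    exact congr($h (Z ((extChartAt I x).symm y)))
  have hX := key X
  have hY := key Y
  obtain ⟨X', hX'⟩ : ∃ X' : E → E, X' =
    VectorField.mpullbackWithin 𝓘(ℝ, E) I (extChartAt I x).symm X (range I) := ⟨_, rfl⟩
  obtain ⟨Y', hY'⟩ : ∃ Y' : E → E, Y' =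
    VectorField.mpullbackWithin 𝓘(ℝ, E) I (extChartAt I x).symm Y (range I) := ⟨_, rfl⟩
  rw [← hX'] at hX
  rw [← hY'] at hY
  have h : VectorField.mlieBracket I X Y x = (chartDeriv I x x).inverse
      (VectorField.lieBracketWithin ℝ X' Y'
        ((extChartAt I x).symm ⁻¹' univ ∩ range I) (extChartAt I x x)) := by
    rw [hX', hY']
    rfl
  rw [h, chartDeriv_self, ContinuousLinearMap.inverse_id, ModelWithCorners.range_eq_univ,
    preimage_univ, inter_univ, VectorField.lieBracketWithin_univ,
    Filter.EventuallyEq.lieBracket_vectorField_eq hX hY, VectorField.lieBracket,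
    fieldInChart_self, fieldInChart_self]
  rfl

end Dirac

section DiracStructure

variable {E : Type*} [NormedAddCommGroup E] [NormedSpace ℝ E]
  {H : Type*} [TopologicalSpace H] (I : ModelWithCorners ℝ E H)
  {M : Type*} [TopologicalSpace M] [ChartedSpace H M] [I.Boundaryless] [IsManifold I ∞ M]
  {η : ∀ x : M, CotangentSpace I x}

theorem contDiffAt_formInChart (hη : SmoothFormOn I η univ) (x₀ : M) {y : E}
    (hy : y ∈ (extChartAt I x₀).target) : ContDiffAt ℝ ∞ (formInChart I η x₀) y := by
  have h := (contMDiffAt_form_iff I η x₀ ((extChartAt I x₀).map_target hy)).1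
    ((hη _ (mem_univ _)).contMDiffAt Filter.univ_mem)
  rwa [(extChartAt I x₀).right_inv hy] at h

/-- The bracket of two sections of the graph of `dη + dt ∧ η` lies in the graph. -/
theorem courantBracket_mem_contactDirac (hη : SmoothFormOn I η univ)
    {σ τ : ∀ x : M, E1Fiber I x} (hσ : SmoothSectionOn I σ univ) (hτ : SmoothSectionOn I τ univ)
    (hσL : ∀ x, σ x ∈ contactDirac I η x) (hτL : ∀ x, τ x ∈ contactDirac I η x) (x : M) :
    courantBracket I σ τ x ∈ contactDirac I η x := by
  obtain ⟨X, hX⟩ : ∃ X : (∀ x : M, TangentSpace I x), X = fun x => (σ x).1.1 := ⟨_, rfl⟩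
  obtain ⟨Y, hY⟩ : ∃ Y : (∀ x : M, TangentSpace I x), Y = fun x => (τ x).1.1 := ⟨_, rfl⟩
  obtain ⟨f, hf⟩ : ∃ f : M → ℝ, f = fun x => (σ x).1.2 := ⟨_, rfl⟩
  obtain ⟨g, hg⟩ : ∃ g : M → ℝ, g = fun x => (τ x).1.2 := ⟨_, rfl⟩
  have eσ : σ = fun x => ((X x, f x), graphForm I η X f x) := by
    funext x
    refine Prod.ext (by rw [hX, hf]) (((mem_contactDirac_iff I hη x _).1 (hσL x)).trans ?_)
    rw [hX, hf]
    rfl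
  have eτ : τ = fun x => ((Y x, g x), graphForm I η Y g x) := by
    funext x
    refine Prod.ext (by rw [hY, hg]) (((mem_contactDirac_iff I hη x _).1 (hτL x)).trans ?_)
    rw [hY, hg]
    rfl
  have hxs := mem_extChartAt_source (I := I) x
  have cX : ContDiffAt ℝ ∞ (fieldInChart I X x) (extChartAt I x x) := by
    rw [hX]
    exact (contMDiffAt_field_iff I _ x hxs).1 ((hσ.vector x (mem_univ _)).contMDiffAt
      Filter.univ_mem)
  have cY : ContDiffAt ℝ ∞ (fieldInChart I Y x) (extChartAt I x x) := by
    rw [hY]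
    exact (contMDiffAt_field_iff I _ x hxs).1 ((hτ.vector x (mem_univ _)).contMDiffAt
      Filter.univ_mem)
  have cf : ContDiffAt ℝ ∞ (f ∘ (extChartAt I x).symm) (extChartAt I x x) := by
    rw [hf]
    exact (contMDiffAt_iff_comp_extChartAt_symm I x hxs _).1 ((hσ.func x (mem_univ _)).contMDiffAt
      Filter.univ_mem)
  have cg : ContDiffAt ℝ ∞ (g ∘ (extChartAt I x).symm) (extChartAt I x x) := by
    rw [hg]
    exact (contMDiffAt_iff_comp_extChartAt_symm I x hxs _).1 ((hτ.func x (mem_univ _)).contMDiffAt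
      Filter.univ_mem)
  have cη := contDiffAt_formInChart I hη x (mem_extChartAt_target x)
  clear hX hY hf hg
  subst eσ eτ
  have ht := extChartAt_target_mem_nhds (I := I) x
  have hdη : ∀ y ∈ (extChartAt I x).target, DifferentiableAt ℝ (formInChart I η x) y := fun y hy =>
    (contDiffAt_formInChart I hη x hy).differentiableAt (by simp)
  have hxs := (extChartAt I x).left_inv hxs
  have hcomp : ∀ F : M → ℝ, (F ∘ (extChartAt I x).symm) (extChartAt I x x) = F x :=
    fun F => congrArg F hxs
  obtain ⟨α, hα⟩ : ∃ α : (∀ x : M, TangentSpace I x) → (M → ℝ) → M → E →L[ℝ] ℝ,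
    α = fun Z k x => horizontalPart I (graphForm I η Z k x) := ⟨_, rfl⟩
  obtain ⟨φ, hφ⟩ : ∃ φ : (∀ x : M, TangentSpace I x) → (M → ℝ) → M → ℝ,
    φ = fun Z k x => verticalPart I (graphForm I η Z k x) := ⟨_, rfl⟩
  obtain ⟨h, hh⟩ : ∃ h : M → ℝ, h = fun x => graphForm I η Y g x (X x, f x) := ⟨_, rfl⟩
  obtain ⟨X₀, hX₀⟩ : ∃ X₀ : E, X₀ = X x := ⟨_, rfl⟩
  obtain ⟨Y₀, hY₀⟩ : ∃ Y₀ : E, Y₀ = Y x := ⟨_, rfl⟩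
  have hX₀' := (fieldInChart_self I X x).trans hX₀.symm
  have hY₀' := (fieldInChart_self I Y x).trans hY₀.symm
  have eα : ∀ Z k, formInChart I (α Z k) x =ᶠ[𝓝 (extChartAt I x x)]
      flatContact (formInChart I η x) (fieldInChart I Z x) (k ∘ (extChartAt I x).symm) := by
    intro Z k
    filter_upwards [ht] with y hy
    rw [hα]
    exact formInChart_horizontalPart I hy (hdη y hy) Z k
  have eφ : ∀ Z k, φ Z k ∘ (extChartAt I x).symm =ᶠ[𝓝 (extChartAt I x x)]
      fun y => - formInChart I η x y (fieldInChart I Z x y) := by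
    intro Z k
    filter_upwards [ht] with y hy
    rw [hφ]
    exact verticalPart_graphForm I hy Z k
  have eh : h ∘ (extChartAt I x).symm =ᶠ[𝓝 (extChartAt I x x)] fun y =>
      flatContact (formInChart I η x) (fieldInChart I Y x) (g ∘ (extChartAt I x).symm) y
          (fieldInChart I X x y) -
        (f ∘ (extChartAt I x).symm) y * formInChart I η x y (fieldInChart I Y x y) := by
    filter_upwards [ht] with y hy
    rw [hh]
    exact graphForm_apply I hy (hdη y hy) X Y f g
  have vα : ∀ Z k, α Z k x = flatContact (formInChart I η x) (fieldInChart I Z x)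
      (k ∘ (extChartAt I x).symm) (extChartAt I x x) := fun Z k =>
    (formInChart_self I (α Z k) x).symm.trans (eα Z k).eq_of_nhds
  have vh := (hcomp h).symm.trans eh.eq_of_nhds
  have dα : ∀ Z k u v, extD I (α Z k) x u v = _ := fun Z k => extD_eq_of_eventuallyEq I (eα Z k)
  have dφ : ∀ Z k, ContDiffAt ℝ ∞ (fieldInChart I Z x) (extChartAt I x x) → ∀ u,
      modelDeriv I 𝓘(ℝ, ℝ) (φ Z k) x u = _ := fun Z k hZ =>
    modelDeriv_eq_of_eventuallyEq I (eφ Z k) (cη.clm_apply hZ).neg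
  have dh : ∀ u, modelDeriv I 𝓘(ℝ, ℝ) h x u = _ := modelDeriv_eq_of_eventuallyEq I eh
    (((contDiffAt_flatContact cη cY cg).clm_apply cX).sub (cf.mul (cη.clm_apply cY)))
  have df : ∀ k : M → ℝ, ContDiffAt ℝ ∞ (k ∘ (extChartAt I x).symm) (extChartAt I x x) → ∀ u,
      modelDeriv I 𝓘(ℝ, ℝ) k x u = _ := fun k hk =>
    modelDeriv_eq_of_eventuallyEq I (Filter.EventuallyEq.refl _ _) hk
  rw [mem_contactDirac_iff I hη]
  refine ContinuousLinearMap.ext fun (w : E × ℝ) => ?_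
  have hval : (courantBracket I (fun x => ((X x, f x), graphForm I η X f x))
      (fun x => ((Y x, g x), graphForm I η Y g x)) x).2 w =
      (modelDeriv I 𝓘(ℝ, ℝ) h x w.1 + h x * w.2) +
      ((extD I (α Y g) x X₀ w.1 - f x * modelDeriv I 𝓘(ℝ, ℝ) (φ Y g) x w.1 +
          f x * α Y g x w.1) +
        (modelDeriv I 𝓘(ℝ, ℝ) (φ Y g) x X₀ - α Y g x X₀) * w.2) -
      ((extD I (α X f) x Y₀ w.1 - g x * modelDeriv I 𝓘(ℝ, ℝ) (φ X f) x w.1 +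
          g x * α X f x w.1) +
        (modelDeriv I 𝓘(ℝ, ℝ) (φ X f) x Y₀ - α X f x Y₀) * w.2) := by
    rw [hX₀, hY₀, hα, hφ, hh]
    rfl
  obtain ⟨B₀, hB₀⟩ : ∃ B₀ : E, B₀ = VectorField.mlieBracket I X Y x := ⟨_, rfl⟩
  have hfst : contactForm I η x (courantBracket I (fun x => ((X x, f x), graphForm I η X f x))
      (fun x => ((Y x, g x), graphForm I η Y g x)) x).1 w =
      contactForm I η x (B₀, modelDeriv I 𝓘(ℝ, ℝ) g x X₀ - modelDeriv I 𝓘(ℝ, ℝ) f x Y₀) w := by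
    rw [hB₀, hX₀, hY₀]
    rfl
  refine hval.trans (Eq.trans ?_ hfst.symm)
  have eη : ∀ v : E, η x v = formInChart I η x (extChartAt I x x) v := fun v =>
    congr($(formInChart_self I η x) v).symm
  have hbr : B₀ = fderiv ℝ (fieldInChart I Y x) (extChartAt I x x) X₀ -
      fderiv ℝ (fieldInChart I X x) (extChartAt I x x) Y₀ := by
    rw [hB₀, hX₀, hY₀]
    exact mlieBracket_eq_fieldInChart I X Y x
  have H := flat_involutive_horizontal cη cX cY cf cg w.1
  have V := flat_involutive_vertical (f := f ∘ (extChartAt I x).symm)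
    (g := g ∘ (extChartAt I x).symm) cη cX cY
  rw [contactForm_apply, dh, dα, dα, dφ Y g cY, dφ Y g cY, dφ X f cX, dφ X f cX, vα, vα, vh,
    df g cg, df f cf, extD_eq_of_eventuallyEq I (Filter.EventuallyEq.refl _ _)]
  simp only [hX₀', hY₀', hcomp] at H V ⊢
  have e1 := eη B₀
  have e2 := eη w.1
  rw [hbr] at e1 ⊢
  linear_combination H + w.2 * V + w.2 * e1 -
    (fderiv ℝ (g ∘ (extChartAt I x).symm) (extChartAt I x x) X₀ -
      fderiv ℝ (f ∘ (extChartAt I x).symm) (extChartAt I x x) Y₀) * e2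

theorem mem_contactDirac_iff_pairing (hη : SmoothFormOn I η univ) (x : M) (e : E1Fiber I x) :
    e ∈ contactDirac I η x ↔ ∀ u ∈ contactDirac I η x, pairing I e u = 0 := by
  have hskew : ∀ u v : E × ℝ, contactForm I η x u v = - contactForm I η x v u := by
    intro u v
    rw [contactForm_apply, contactForm_apply, extD_apply, extD_apply]
    ring
  obtain ⟨u, β⟩ := e
  rw [mem_contactDirac_iff I hη]
  constructor
  · rintro h ⟨v, γ⟩ hv
    rw [mem_contactDirac_iff I hη] at hv
    have h1 : β = contactForm I η x u := h
    have h2 : γ = contactForm I η x v := hv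
    change γ u + β v = 0
    rw [h1, h2]
    exact (congrArg (· + _) (hskew v u)).trans (neg_add_cancel _)
  · intro h
    refine ContinuousLinearMap.ext fun v => ?_
    have h1 := h (v, contactForm I η x v) ((mem_contactDirac_iff I hη x _).2 rfl)
    have h2 : contactForm I η x v u + (show E × ℝ →L[ℝ] ℝ from β) v = 0 := h1
    have h3 := hskew v u
    change (show E × ℝ →L[ℝ] ℝ from β) v = contactForm I η x u v
    linarith

end DiracStructure

section Subbundle

variable {E : Type*} [NormedAddCommGroup E] [NormedSpace ℝ E]
  {H : Type*} [TopologicalSpace H] (I : ModelWithCorners ℝ E H)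
  {M : Type*} [TopologicalSpace M] [ChartedSpace H M] [IsManifold I ∞ M]

/-- The vector field that is constant in the chart at `x₀`. -/
noncomputable def coordField (x₀ : M) (v : E) (x : M) : TangentSpace I x :=
  chartSymmDeriv I x₀ (extChartAt I x₀ x) v

theorem fieldInChart_coordField (x₀ : M) (v : E) {y : E} (hy : y ∈ (extChartAt I x₀).target) :
    fieldInChart I (coordField I x₀ v) x₀ y = v := by
  have h := chartDeriv_chartSymmDeriv I x₀ hy v
  rw [← (extChartAt I x₀).right_inv hy] at h
  rw [(extChartAt I x₀).left_inv ((extChartAt I x₀).map_target hy)] at h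
  exact h

variable [I.Boundaryless] {η : ∀ x : M, CotangentSpace I x}

variable (η) in
/-- The section of the graph of `dη + dt ∧ η` over a field that is constant in a chart. -/
noncomputable def coordSection (x₀ : M) (w : E × ℝ) (x : M) : E1Fiber I x :=
  ((coordField I x₀ w.1 x, w.2), graphForm I η (coordField I x₀ w.1) (fun _ => w.2) x)

theorem smoothSectionOn_coordSection (hη : SmoothFormOn I η univ) (x₀ : M) (w : E × ℝ) :
    SmoothSectionOn I (coordSection I η x₀ w) (extChartAt I x₀).source := by
  have ht : ∀ x ∈ (extChartAt I x₀).source,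
      (extChartAt I x₀).target ∈ 𝓝 (extChartAt I x₀ x) := fun x hx =>
    (isOpen_extChartAt_target x₀).mem_nhds ((extChartAt I x₀).map_source hx)
  have cX : ∀ x ∈ (extChartAt I x₀).source,
      ContDiffAt ℝ ∞ (fieldInChart I (coordField I x₀ w.1) x₀) (extChartAt I x₀ x) := by
    intro x hx
    refine (contDiffAt_const (c := w.1)).congr_of_eventuallyEq ?_
    filter_upwards [ht x hx] with y hy
    exact fieldInChart_coordField I x₀ w.1 hy
  refine ⟨fun x hx => ?_, contMDiffOn_const, fun x hx => ?_, fun x hx => ?_⟩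
  · exact ((contMDiffAt_field_iff I (coordField I x₀ w.1) x₀ hx).2 (cX x hx)).contMDiffWithinAt
  · refine ((contMDiffAt_form_iff I _ x₀ hx).2 ?_).contMDiffWithinAt
    refine (contDiffAt_flatContact (contDiffAt_formInChart I hη x₀ (mem_of_mem_nhds (ht x hx)))
      (cX x hx) (contDiffAt_const (c := w.2))).congr_of_eventuallyEq ?_
    filter_upwards [ht x hx] with y hy
    exact formInChart_horizontalPart I hy
      ((contDiffAt_formInChart I hη x₀ hy).differentiableAt (by simp)) _ (fun _ => w.2)
  · refine ((contMDiffAt_iff_comp_extChartAt_symm I x₀ hx _).2 ?_).contMDiffWithinAt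
    refine ((contDiffAt_formInChart I hη x₀ (mem_of_mem_nhds (ht x hx))).clm_apply
      (cX x hx)).neg.congr_of_eventuallyEq ?_
    filter_upwards [ht x hx] with y hy
    exact verticalPart_graphForm I hy (coordField I x₀ w.1) (fun _ => w.2)

variable (η) in
/-- The values of `coordSection` at a point, as a linear map. -/
noncomputable def coordSectionMap (x₀ x : M) : E × ℝ →ₗ[ℝ] (E × ℝ) × (E × ℝ →L[ℝ] ℝ) :=
  (LinearMap.id.prod (contactForm I η x).toLinearMap).comp
    ((chartSymmDeriv I x₀ (extChartAt I x₀ x)).toLinearMap.prodMap LinearMap.id)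

variable [FiniteDimensional ℝ E]

theorem exists_frame_contactDirac (hη : SmoothFormOn I η univ) (x₀ : M) :
    ∃ U : Set M, IsOpen U ∧ x₀ ∈ U ∧ ∃ (k : ℕ) (b : Fin k → ∀ x : M, E1Fiber I x),
      (∀ i, SmoothSectionOn I (b i) U) ∧ ∀ x ∈ U, LinearIndependent ℝ (fun i => b i x) ∧
        Submodule.span ℝ (range fun i => b i x) = contactDirac I η x := by
  have B := Module.finBasis ℝ (E × ℝ)
  refine ⟨_, isOpen_extChartAt_source x₀, mem_extChartAt_source x₀, _,
    fun i => coordSection I η x₀ (B i), fun i => smoothSectionOn_coordSection I hη x₀ (B i),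
    fun x hx => ?_⟩
  have hinv := chartSymmDeriv_chartDeriv I x₀ hx
  have hinj : Function.Injective (coordSectionMap I η x₀ x) := by
    have hL : Function.LeftInverse (chartDeriv I x₀ x)
        (chartSymmDeriv I x₀ (extChartAt I x₀ x)) := by
      intro v
      have h := chartDeriv_chartSymmDeriv I x₀ ((extChartAt I x₀).map_source hx) v
      rwa [(extChartAt I x₀).left_inv hx] at h
    intro u v huv
    have h1 := congrArg Prod.fst huv
    exact Prod.ext (hL.injective (congrArg Prod.fst h1))
      (congrArg (fun p : E × ℝ => p.2) h1 :)
  have hb : (fun i => coordSection I η x₀ (B i) x) = coordSectionMap I η x₀ x ∘ B := rfl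
  constructor
  · rw [hb]
    exact B.linearIndependent.map' _ (LinearMap.ker_eq_bot.2 hinj)
  · have h1 : Submodule.span ℝ (range (coordSectionMap I η x₀ x ∘ B)) =
        LinearMap.range (coordSectionMap I η x₀ x) := by
      rw [range_comp, Submodule.span_image, B.span_eq, Submodule.map_top]
    refine h1.trans (Submodule.ext fun e => ?_)
    refine Iff.trans ?_ (mem_contactDirac_iff I hη x e).symm
    constructor
    · rintro ⟨w, rfl⟩
      rfl
    · obtain ⟨u, β⟩ := e
      intro h
      refine ⟨(chartDeriv I x₀ x u.1, u.2), ?_⟩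
      have h2 : (chartSymmDeriv I x₀ (extChartAt I x₀ x) (chartDeriv I x₀ x u.1), u.2) = u :=
        Prod.ext (hinv u.1) rfl
      exact Prod.ext h2 ((congrArg (contactForm I η x) h2).trans h.symm)

theorem isE1Dirac_contactDirac (hη : SmoothFormOn I η univ) :
    IsE1Dirac I (contactDirac I η) :=
  ⟨exists_frame_contactDirac I hη, mem_contactDirac_iff_pairing I hη,
    fun _ _ hσ hτ hσL hτL => courantBracket_mem_contactDirac I hη hσ hτ hσL hτL⟩

end Subbundle

section Criterion

variable {E : Type*} [NormedAddCommGroup E] [NormedSpace ℝ E]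
  {H : Type*} [TopologicalSpace H] {I : ModelWithCorners ℝ E H}
  {M : Type*} [TopologicalSpace M] [ChartedSpace H M] [IsManifold I ∞ M] [I.Boundaryless]

/-- The graph of `dη + dt ∧ η` is transverse to `A` if and only if `dη` is non-degenerate
on `ker η`. -/
theorem contactDirac_inf_splittingA_eq_bot_iff {η : ∀ x : M, CotangentSpace I x}
    (hη : SmoothFormOn I η univ) {x : M} (hx : η x ≠ 0) :
    contactDirac I η x ⊓ splittingA I x = ⊥ ↔
      ∀ v : E, η x v = 0 → (∀ w : E, η x w = 0 → extD I η x v w = 0) → v = 0 := by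
  have hker : contactDirac I η x ⊓ splittingA I x = ⊥ ↔
      ∀ u : E × ℝ, contactForm I η x u = 0 → u = 0 := by
    rw [Submodule.eq_bot_iff]
    constructor
    · intro h u hu
      have h1 := h ((u, 0) : E1Fiber I x)
        ⟨(mem_contactDirac_iff I hη x _).2 hu.symm, ⟨u, rfl⟩⟩
      exact congrArg Prod.fst h1
    · rintro h e ⟨h1, ⟨u, rfl⟩⟩
      have h2 : (u : E × ℝ) = 0 := h u ((mem_contactDirac_iff I hη x _).1 h1).symm
      exact Prod.ext h2 rfl
  obtain ⟨z, hz⟩ : ∃ z : E, η x z ≠ 0 := by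
    by_contra! h
    exact hx (ContinuousLinearMap.ext h)
  rw [hker]
  constructor
  · intro h v hv hvw
    have h1 := h (v, - extD I η x v z / η x z) (ContinuousLinearMap.ext fun w => ?_)
    · exact congrArg Prod.fst h1
    · have h2 := hvw (w.1 - (η x w.1 / η x z) • z) (by
        have := map_sub (η x : E →L[ℝ] ℝ) w.1 ((η x w.1 / η x z) • z)
        have h3 := map_smul (η x : E →L[ℝ] ℝ) (η x w.1 / η x z) z
        refine this.trans ?_
        rw [h3]
        exact sub_eq_zero.2 (div_mul_cancel₀ _ hz).symm)
      rw [map_sub, map_smul, smul_eq_mul] at h2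
      rw [contactForm_apply]
      change _ = (0 : ℝ)
      simp only [hv]
      linear_combination h2
  · rintro h ⟨v, a⟩ hu
    have hv : η x v = 0 := by
      have h1 := congr($hu ((0, 1) : E × ℝ))
      rw [contactForm_apply] at h1
      have h2 : extD I η x v 0 = 0 := map_zero _
      have h3 : η x (0 : E) = 0 := map_zero _
      have h4 : extD I η x v 0 + a * η x (0 : E) - η x v * 1 = 0 := h1
      linear_combination h2 + a * h3 - h4
    have hw : ∀ w : E, extD I η x v w + a * η x w = 0 := by
      intro w
      have h1 := congr($hu ((w, 0) : E × ℝ))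
      rw [contactForm_apply] at h1
      have h4 : extD I η x v w + a * η x w - η x v * 0 = 0 := h1
      linear_combination h4
    have hv0 : v = 0 := h v hv fun w hw' => by
      have := hw w
      rw [hw'] at this
      linear_combination this
    have ha : a = 0 := by
      have := hw z
      rw [hv0, map_zero] at this
      have h5 : a * η x z = 0 := by simpa using this
      exact (mul_eq_zero.1 h5).resolve_right hz
    rw [hv0, ha]
    rfl

/-- If two 1-forms have the same kernels near a point, their derivatives are proportional
on the kernel. -/
theorem exists_extD_eq_smul {η η' : ∀ x : M, CotangentSpace I x} {U : Set M} (hU : IsOpen U)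
    (hη : SmoothFormOn I η U) (hη' : SmoothFormOn I η' U)
    (hker : ∀ x ∈ U, ∀ v : E, η' x v = 0 ↔ η x v = 0) {x : M} (hx : x ∈ U) (hx0 : η x ≠ 0) :
    ∃ c : ℝ, c ≠ 0 ∧ ∀ v w : E, η x v = 0 → η x w = 0 →
      extD I η' x v w = c * extD I η x v w := by
  obtain ⟨z, hz⟩ : ∃ z : E, η x z ≠ 0 := by
    by_contra! h
    exact hx0 (ContinuousLinearMap.ext h)
  have hz' : η' x z ≠ 0 := fun h => hz ((hker x hx z).1 h)
  have hxs := mem_extChartAt_source (I := I) x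
  obtain ⟨a, ha⟩ : ∃ a, a = formInChart I η x := ⟨_, rfl⟩
  obtain ⟨b, hb⟩ : ∃ b, b = formInChart I η' x := ⟨_, rfl⟩
  obtain ⟨y, hy⟩ : ∃ y, y = extChartAt I x x := ⟨_, rfl⟩
  have ca : ContDiffAt ℝ ∞ a y := by
    rw [ha, hy]
    exact (contMDiffAt_form_iff I η x hxs).1 ((hη x hx).contMDiffAt (hU.mem_nhds hx))
  have cb : ContDiffAt ℝ ∞ b y := by
    rw [hb, hy]
    exact (contMDiffAt_form_iff I η' x hxs).1 ((hη' x hx).contMDiffAt (hU.mem_nhds hx))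
  have ea : ∀ v : E, η x v = a y v := fun v => by
    rw [ha, hy]; exact congr($(formInChart_self I η x) v).symm
  have eb : ∀ v : E, η' x v = b y v := fun v => by
    rw [hb, hy]; exact congr($(formInChart_self I η' x) v).symm
  have hk : ∀ᶠ q in 𝓝 y, ∀ v, a q v = 0 → b q v = 0 := by
    have hc := continuousAt_extChartAt_symm (I := I) x
    have h1 : ∀ᶠ q in 𝓝 (extChartAt I x x), (extChartAt I x).symm q ∈ U :=
      hc.eventually_mem (hU.mem_nhds (by rwa [(extChartAt I x).left_inv hxs]))
    rw [hy]
    filter_upwards [h1] with q hq v hv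
    rw [hb, formInChart_apply]
    rw [ha, formInChart_apply] at hv
    exact (hker _ hq _).2 hv
  have haz : a y z ≠ 0 := by rwa [← ea]
  have hbz : b y z ≠ 0 := by rwa [← eb]
  have hne : ∀ᶠ q in 𝓝 y, a q z ≠ 0 :=
    (ca.continuousAt.clm_apply continuousAt_const).eventually_ne haz
  have cg : DifferentiableAt ℝ (fun q => b q z / a q z) y :=
    ((cb.clm_apply contDiffAt_const).div (ca.clm_apply contDiffAt_const)
      haz).differentiableAt (by simp)
  have da : DifferentiableAt ℝ a y := ca.differentiableAt (by simp)
  have hE : b =ᶠ[𝓝 y] fun q => (b q z / a q z) • a q := by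
    filter_upwards [hk, hne] with q hq hqz
    refine ContinuousLinearMap.ext fun v => ?_
    have h1 := hq (v - (a q v / a q z) • z) (by
      rw [map_sub, map_smul, smul_eq_mul, div_mul_cancel₀ _ hqz, sub_self])
    rw [map_sub, map_smul, smul_eq_mul] at h1
    rw [smul_apply, smul_eq_mul]
    linear_combination h1
  refine ⟨b y z / a y z, div_ne_zero hbz haz, fun v w hv hw => ?_⟩
  rw [ea] at hv hw
  rw [extD_apply, extD_apply, ← ha, ← hb, ← hy, hE.fderiv_eq, fderiv_fun_smul cg da]
  simp [hv, hw]
  ring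

namespace CoorientedDistribution

variable (ξ : CoorientedDistribution I M)

/-- A positive form defines a contact structure if and only if the graph of `dη + dt ∧ η` is
transverse to `A`. -/
theorem isContact_iff {η : ∀ x : M, CotangentSpace I x} (hη : ξ.IsPositiveForm η) :
    ξ.IsContact ↔ ∀ x : M, contactDirac I η x ⊓ splittingA I x = ⊥ := by
  have hp := fun x => ξ.pos_eq_of_mem (hη.2 x)
  constructor
  · intro h x
    rw [contactDirac_inf_splittingA_eq_bot_iff hη.1 (hp x).1]
    intro v hv hvw
    refine h univ η isOpen_univ hη.1 (fun x _ => (hp x).2.1) x (mem_univ _) v ?_ fun w hw => ?_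
    · rw [(hp x).2.1]
      exact hv
    · rw [(hp x).2.1] at hw
      exact hvw w hw
  · intro h U η' hU hη' hker x hx v hv hvw
    have h1 := (contactDirac_inf_splittingA_eq_bot_iff hη.1 (hp x).1).1 (h x)
    obtain ⟨c, hc, hcd⟩ := exists_extD_eq_smul hU (hη.1.mono (subset_univ U)) hη'
      (fun x hx v => by
        have h2 := (hker x hx).symm.trans (hp x).2.1
        exact iff_of_eq (congrArg (fun S : Submodule ℝ (TangentSpace I x) => v ∈ S) h2)) hx (hp x).1
    rw [(hp x).2.1] at hv
    refine h1 v hv fun w hw => ?_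
    have h2 : extD I η' x v w = 0 := hvw w (by rw [(hp x).2.1]; exact hw)
    rw [hcd v w hv hw] at h2
    exact (mul_eq_zero.1 h2).resolve_left hc

end CoorientedDistribution

end Criterion

end ContactDirac

theorem mainTheorem7
    {E : Type*} [NormedAddCommGroup E] [NormedSpace ℝ E] [FiniteDimensional ℝ E]
    {H : Type*} [TopologicalSpace H] (I : ModelWithCorners ℝ E H) [I.Boundaryless]
    (M : Type*) [TopologicalSpace M] [ChartedSpace H M] [IsManifold I ∞ M]
    [T2Space M] [SigmaCompactSpace M]
    (ξ : ContactDirac.CoorientedDistribution I M) :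
    -- the cone has a global section
    (∃ η, ξ.IsPositiveForm η) ∧
    ∀ η, ξ.IsPositiveForm η →
      -- it identifies `M × ℝ` with the submanifold `Ann⁺(ξ)` of `T^*M`, equivariantly
      (ContMDiff (I.prod 𝓘(ℝ, ℝ)) (I.prod 𝓘(ℝ, E →L[ℝ] ℝ)) ∞ (ContactDirac.coneMap I η) ∧
        IsEmbedding (ContactDirac.coneMap I η) ∧
        (∀ p, Function.Injective (mfderiv (I.prod 𝓘(ℝ, ℝ)) (I.prod 𝓘(ℝ, E →L[ℝ] ℝ))
          (ContactDirac.coneMap I η) p)) ∧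
        range (ContactDirac.coneMap I η) = ξ.annPos ∧
        ∀ (t : ℝ) (p : M × ℝ), ContactDirac.coneMap I η (ContactDirac.translate t p) =
          ContactDirac.covectorPoint I p.1 (Real.exp t • (ContactDirac.coneMap I η p).2)) ∧
      -- the graph of `ω_N` is invariant
      (∀ (t : ℝ) (p : M × ℝ),
        (ContactDirac.coneGraph I η p).map (ContactDirac.shift I t p).toLinearMap =
          ContactDirac.coneGraph I η (ContactDirac.translate t p)) ∧
      -- its image in the quotient is the Dirac structure of `ξ`
      (∀ p : M × ℝ, (ContactDirac.coneGraph I η p).map (ContactDirac.toQuotient I p).toLinearMap =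
        ContactDirac.contactDirac I η p.1) ∧
      ContactDirac.IsE1Dirac I (ContactDirac.contactDirac I η) ∧
      -- the criterion
      (ξ.IsContact ↔
        ∀ x : M, ContactDirac.contactDirac I η x ⊓ ContactDirac.splittingA I x = ⊥) := by
  refine ⟨ξ.exists_isPositiveForm, fun η hη => ?_⟩
  have h0 : ∀ x, η x ≠ 0 := fun x => (ξ.pos_eq_of_mem (hη.2 x)).1
  exact ⟨⟨ContactDirac.contMDiff_coneMap I hη.1, ContactDirac.isEmbedding_coneMap I hη.1 h0,
      ContactDirac.injective_mfderiv_coneMap I hη.1 h0, ξ.range_coneMap hη,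
      ContactDirac.CoorientedDistribution.coneMap_translate η⟩,
    ContactDirac.map_shift_coneGraph I hη.1, ContactDirac.map_toQuotient_coneGraph I hη.1,
    ContactDirac.isE1Dirac_contactDirac I hη.1, ξ.isContact_iff hη⟩
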